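/- Let $U_0,U_1$ be unitary matrices of the same finite size $d\ge 1$, let $\Lambda_j(X)=U_jXU_j^\dagger$, and let $N\ge 1$. For $k\in\{0,\dots,N\}$ let $\mathcal E_k$ be the process made of $N$ successive channels, the $n$-th of which ($1\le n\le N$) is $\Lambda_1$ if $k<n$ and $\Lambda_0$ if $k\ge n$. A discrimination strategy (tester) prepares a state of the input system and a finite-dimensional ancilla, inserts the $N$ channels one after another with arbitrary quantum channels acting on system and ancilla in between, and finally performs a measurement with outcomes $0,\dots,N$ and "unknown"; it is unambiguous if outcome $m\in\{0,\dots,N\}$ has probability $0$ on $\mathcal E_k$ whenever $m\ne k$. Let $P^{(N)}$ be the maximum over unambiguous testers of $\frac1{N+1}\sum_{k=0}^N p_k$, where $p_k$ is the probability of outcome $k$ on $\mathcal E_k$. In the same sense consider unambiguous discrimination of $\Lambda_0$ and $\Lambda_1$, used once. Let $\overline p$ be the maximum probability with which $\Lambda_0$ can be correctly identified, and for $p\in[0,\overline p]$ let $f(p)$ be the maximum probability of correctly identifying $\Lambda_1$ when $\Lambda_0$ is correctly identified with probability $p$. Let $\overline P^{(N)}$ be the maximum of $\frac1{N+1}\sum_{i=0}^N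 p_i$ subject to $p_N\in[0,\overline p]$ and $p_{i-1}\in[0,f(p_i)]$ for $i=1,\dots,N$. Then all these maxima are attained, $f(0)\le\overline p$, and $$P^{(N)}=\overline P^{(N)}=1-t\cdot\frac{(N+2)c+Nc^{-1}}{2(N+1)},$$ where $t=\min_{\varphi}|\langle\varphi|U_0^\dagger U_1|\varphi\rangle|$ over unit vectors $\varphi$ (the minimum is attained), $c=1$ if $N$ is odd, and $c=\max\{t,\sqrt{N/(N+2)}\}$ if $N$ is even. Moreover, let $c_i=c$ for even $i$ and $c_i=c^{-1}$ for odd $i$, and let $\varphi$ be a unit vector and $u$ a complex number with $|u|=1$ and $\langle\varphi|U_0^\dagger U_1|\varphi\rangle=tu$. Then there is an unambiguous tester with a pure input state, unitary intermediate channels and an ancilla of fixed dimension that attains $P^{(N)}$, identifies $\mathcal E_k$ correctly with probability $1-tc_k$ for every $k$, and whose state vectors $|\psi_0\rangle,\dots,|\psi_N\rangle$ before the measurement, for the change points $0,\dots,N$, have the Gram matrix $$\bigl(\langle\psi_i|\psi_j\rangle\bigr)_{i,j=0}^N=\sum_{i=0}^N(1-tc_i)|i\rangle\langle i|+t|\mu\rangle\langle\mu|,\qquad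 |\mu\rangle=\sum_{i=0}^N u^i\sqrt{c_i}\,|i\rangle .$$ -/

import Mathlib

open scoped ComplexOrder Kronecker

namespace ChangePoint

/-! ### States, channels, measurements -/

/-- `Φ ⊗ id_a`, the map `Φ` applied to the first tensor factor (`Φ` acts on every block of `X`). -/
def ampliation {m n : Type*} (a : Type*) (Φ : Matrix m m ℂ →ₗ[ℂ] Matrix n n ℂ)
    (X : Matrix (m × a) (m × a) ℂ) : Matrix (n × a) (n × a) ℂ :=
  Matrix.of fun p q => Φ (Matrix.of fun i j => X (i, p.2) (j, q.2)) p.1 q.1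

/-- A quantum state (density matrix). -/
structure DensityMatrix (m : Type*) [Fintype m] where
  mat : Matrix m m ℂ
  posSemidef : mat.PosSemidef
  trace_eq_one : mat.trace = 1

/-- A quantum channel: a completely positive trace-preserving linear map. -/
structure Channel (m n : Type*) [Fintype m] [Fintype n] where
  map : Matrix m m ℂ →ₗ[ℂ] Matrix n n ℂ
  completelyPositive : ∀ (k : ℕ) (X : Matrix (m × Fin k) (m × Fin k) ℂ),
    X.PosSemidef → (ampliation (Fin k) map X).PosSemidef
  tracePreserving : ∀ X : Matrix m m ℂ, (map X).trace = X.trace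

/-- A quantum measurement (POVM) with outcomes in `κ`. -/
structure POVM (κ m : Type*) [Fintype κ] [Fintype m] [DecidableEq m] where
  elem : κ → Matrix m m ℂ
  posSemidef : ∀ x, (elem x).PosSemidef
  sum_eq_one : ∑ x, elem x = 1

theorem conj_ampliation {m a : Type*} [Fintype m] [Fintype a] [DecidableEq a]
    (U : Matrix m m ℂ) (Φ : Matrix m m ℂ →ₗ[ℂ] Matrix m m ℂ) (hΦ : ∀ X, Φ X = U * X * U.conjTranspose)
    (X : Matrix (m × a) (m × a) ℂ) :
    ampliation a Φ X = (U ⊗ₖ (1 : Matrix a a ℂ)) * X * (U ⊗ₖ (1 : Matrix a a ℂ)).conjTranspose := by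
  ext ⟨i, x⟩ ⟨j, y⟩
  simp [ampliation, hΦ, Matrix.mul_apply, Fintype.sum_prod_type, Matrix.one_apply,
    Matrix.kroneckerMap_apply, Matrix.conjTranspose_apply, apply_ite]

/-- The unitary channel `X ↦ U X U†`. -/
def unitaryChannel {m : Type*} [Fintype m] [DecidableEq m] (U : Matrix.unitaryGroup m ℂ) :
    Channel m m where
  map :=
    { toFun := fun X => (U : Matrix m m ℂ) * X * (U : Matrix m m ℂ).conjTranspose
      map_add' := fun X Y => by rw [mul_add, add_mul]
      map_smul' := fun z X => by simp }
  completelyPositive := fun k X hX => by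
    rw [conj_ampliation (U : Matrix m m ℂ) _ (fun _ => rfl)]
    exact hX.mul_mul_conjTranspose_same _
  tracePreserving := fun X => by
    have h : (U : Matrix m m ℂ).conjTranspose * (U : Matrix m m ℂ) = 1 :=
      Matrix.UnitaryGroup.star_mul_self U
    change ((U : Matrix m m ℂ) * X * (U : Matrix m m ℂ).conjTranspose).trace = X.trace
    rw [Matrix.trace_mul_comm, ← mul_assoc, h, one_mul]

/-- The pure state `|ξ⟩⟨ξ|` of a normalized vector `ξ`. -/
def pureState {m : Type*} [Fintype m] (ξ : m → ℂ) (hξ : star ξ ⬝ᵥ ξ = 1) : DensityMatrix m where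
  mat := Matrix.vecMulVec ξ (star ξ)
  posSemidef := Matrix.posSemidef_vecMulVec_self_star ξ
  trace_eq_one := by rw [Matrix.trace_vecMulVec, dotProduct_comm, hξ]

/-! ### Testers -/

/-- A general (adaptive, entanglement-assisted) discrimination strategy for processes that consist of
`N ≥ 1` channels from a system `V` to a system `W`, with outcomes in `κ`.
The `(n+1)`-st channel of the process is used while an ancilla of dimension `anc n` is kept;
`interm n` is the channel that is applied between uses `n+1` and `n+2` of the process
(only `n + 1 < N` matters), and `meas` is the final measurement. -/
structure Tester (V W : Type*) [Fintype V] [Fintype W] [DecidableEq W]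
    (N : ℕ) (κ : Type*) [Fintype κ] where
  anc : ℕ → ℕ
  init : DensityMatrix (V × Fin (anc 0))
  interm : ∀ n : ℕ, Channel (W × Fin (anc n)) (V × Fin (anc (n + 1)))
  meas : POVM κ (W × Fin (anc (N - 1)))

namespace Tester

variable {V W : Type*} [Fintype V] [Fintype W] [DecidableEq W] {N : ℕ}

/-- State of `W ⊗ ancilla` just after the `(n+1)`-st channel of the process `E` has been applied.
A process is the sequence `E 1, E 2, …, E N` of its channels. -/
def stateAfter {κ : Type*} [Fintype κ] (T : Tester V W N κ) (E : ℕ → Channel V W) :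
    (n : ℕ) → Matrix (W × Fin (T.anc n)) (W × Fin (T.anc n)) ℂ
  | 0 => ampliation _ (E 1).map T.init.mat
  | n + 1 => ampliation _ (E (n + 2)).map ((T.interm n).map (stateAfter T E n))

/-- Probability of the outcome `x` when the tester is applied to the process `E`. -/
def prob {κ : Type*} [Fintype κ] (T : Tester V W N κ) (E : ℕ → Channel V W) (x : κ) : ℝ :=
  (T.meas.elem x * T.stateAfter E (N - 1)).trace.re

variable {K : Type*} [Fintype K]

/-- The answer `some j` is "the process is `E j`", the answer `none` is "I don't know".
The strategy is unambiguous if it never returns a wrong conclusive answer. -/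
def IsUnambiguous (T : Tester V W N (Option K)) (E : K → ℕ → Channel V W) : Prop :=
  ∀ k j, j ≠ k → T.prob (E k) (some j) = 0

/-- Probability of correctly identifying `E k`. -/
def success (T : Tester V W N (Option K)) (E : K → ℕ → Channel V W) (k : K) : ℝ :=
  T.prob (E k) (some k)

end Tester

/-! ### The change point problem -/

section Problem

variable {V W : Type*} [Fintype V] [Fintype W] [DecidableEq W]

/-- The process with change point `k`: its `n`-th channel, `n = 1, …, N`, is `Λ₁` if `k < n`
and `Λ₀` otherwise. -/
def changeProcess (Λ₀ Λ₁ : Channel V W) (N : ℕ) (k : Fin (N + 1)) (n : ℕ) : Channel V W :=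
  if (k : ℕ) < n then Λ₁ else Λ₀

/-- Average success probability, for equally likely change points `0, …, N`. -/
noncomputable def averageSuccess (Λ₀ Λ₁ : Channel V W) (N : ℕ)
    (T : Tester V W N (Option (Fin (N + 1)))) : ℝ :=
  (∑ k, T.success (changeProcess Λ₀ Λ₁ N) k) / (N + 1)

/-- All average success probabilities of unambiguous strategies for the change point problem. -/
def achievableValues (Λ₀ Λ₁ : Channel V W) (N : ℕ) : Set ℝ :=
  {P | ∃ T : Tester V W N (Option (Fin (N + 1))),
    T.IsUnambiguous (changeProcess Λ₀ Λ₁ N) ∧ averageSuccess Λ₀ Λ₁ N T = P}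

/-- `P^(N)`: the maximum average success probability. -/
noncomputable def optimalSuccess (Λ₀ Λ₁ : Channel V W) (N : ℕ) : ℝ :=
  sSup (achievableValues Λ₀ Λ₁ N)

/-! ### The upper bound from discriminating the two channels -/

/-- The pairs `(p, q)` such that some unambiguous strategy using the channel once identifies
`Λ₀` correctly with probability `p` and `Λ₁` correctly with probability `q`. -/
def pairRegion (Λ₀ Λ₁ : Channel V W) : Set (ℝ × ℝ) :=
  {r | ∃ T : Tester V W 1 (Option (Fin 2)),
    T.IsUnambiguous (fun j _ => ![Λ₀, Λ₁] j) ∧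
    T.success (fun j _ => ![Λ₀, Λ₁] j) 0 = r.1 ∧ T.success (fun j _ => ![Λ₀, Λ₁] j) 1 = r.2}

/-- The probabilities with which `Λ₀` can be correctly identified. -/
def identifiable₀ (Λ₀ Λ₁ : Channel V W) : Set ℝ :=
  {p | ∃ q, (p, q) ∈ pairRegion Λ₀ Λ₁}

/-- The probabilities with which `Λ₁` can be correctly identified when `Λ₀` is correctly
identified with probability `p`. -/
def identifiable₁ (Λ₀ Λ₁ : Channel V W) (p : ℝ) : Set ℝ :=
  {q | (p, q) ∈ pairRegion Λ₀ Λ₁}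

/-- `p̄`: the maximum allowable value of `p`. -/
noncomputable def pbar (Λ₀ Λ₁ : Channel V W) : ℝ := sSup (identifiable₀ Λ₀ Λ₁)

/-- `f p`: the maximum probability of correctly identifying `Λ₁` when `Λ₀` is correctly identified
with probability `p`. -/
noncomputable def tradeoff (Λ₀ Λ₁ : Channel V W) (p : ℝ) : ℝ := sSup (identifiable₁ Λ₀ Λ₁ p)

/-- Values of the problem: maximize `∑ p_i / (N+1)` subject to `p_N ∈ [0, p̄]` and
`p_{i-1} ∈ [0, f(p_i)]` for `i = 1, …, N`. -/
def boundValues (Λ₀ Λ₁ : Channel V W) (N : ℕ) : Set ℝ :=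
  {P | ∃ p : Fin (N + 1) → ℝ,
    p (Fin.last N) ∈ Set.Icc 0 (pbar Λ₀ Λ₁) ∧
    (∀ i : Fin N, p i.castSucc ∈ Set.Icc 0 (tradeoff Λ₀ Λ₁ (p i.succ))) ∧
    (∑ i, p i) / (N + 1) = P}

/-- `Ū^(N)`: the optimal value of that problem. -/
noncomputable def upperBound (Λ₀ Λ₁ : Channel V W) (N : ℕ) : ℝ :=
  sSup (boundValues Λ₀ Λ₁ N)

end Problem

/-! ### Unitary channels -/

section Unitary

variable {ι : Type*} [Fintype ι] [DecidableEq ι]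

/-- `⟨φ|U₀†U₁|φ⟩`. -/
noncomputable def overlap (U₀ U₁ : Matrix.unitaryGroup ι ℂ) (φ : ι → ℂ) : ℂ :=
  star φ ⬝ᵥ (((U₀ : Matrix ι ι ℂ).conjTranspose * (U₁ : Matrix ι ι ℂ)).mulVec φ)

/-- The values `|⟨φ|U₀†U₁|φ⟩|` over all normalized vectors `φ`. -/
def overlapValues (U₀ U₁ : Matrix.unitaryGroup ι ℂ) : Set ℝ :=
  {r | ∃ φ : ι → ℂ, star φ ⬝ᵥ φ = 1 ∧ ‖overlap U₀ U₁ φ‖ = r}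

/-- `t = min_φ |⟨φ|U₀†U₁|φ⟩|`. -/
noncomputable def minOverlap (U₀ U₁ : Matrix.unitaryGroup ι ℂ) : ℝ :=
  sInf (overlapValues U₀ U₁)

/-- `c = 1` for odd `N` and `c = max {t, √(N/(N+2))}` for even `N`. -/
noncomputable def cParam (t : ℝ) (N : ℕ) : ℝ :=
  if Odd N then 1 else max t (Real.sqrt ((N : ℝ) / (N + 2)))

/-- `c_i = c` for even `i` and `c_i = c⁻¹` for odd `i`. -/
noncomputable def cSeq (c : ℝ) (i : ℕ) : ℝ := if Even i then c else c⁻¹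

/-- A sequential strategy with a pure input state and unitary intermediate operations, with an
ancilla of dimension `a`, before the choice of a measurement. -/
structure UnitaryStrategy (ι : Type*) [Fintype ι] [DecidableEq ι] (a : ℕ) where
  vec : ι × Fin a → ℂ
  normalized : star vec ⬝ᵥ vec = 1
  gate : ℕ → Matrix.unitaryGroup (ι × Fin a) ℂ

namespace UnitaryStrategy

variable {a : ℕ}

/-- The tester given by a unitary strategy and a final measurement. -/
def toTester (S : UnitaryStrategy ι a) (N : ℕ) {κ : Type*} [Fintype κ]
    (M : POVM κ (ι × Fin a)) : Tester ι ι N κ where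
  anc := fun _ => a
  init := pureState S.vec S.normalized
  interm := fun n => unitaryChannel (S.gate n)
  meas := M

/-- `|ψ_k^{(n+1)}⟩`: the state vector just after the `(n+1)`-st channel,
when the change point is `k`. -/
noncomputable def psi (S : UnitaryStrategy ι a) (U₀ U₁ : Matrix.unitaryGroup ι ℂ) (k : ℕ) :
    ℕ → (ι × Fin a → ℂ)
  | 0 => (((if k < 1 then U₁ else U₀ : Matrix.unitaryGroup ι ℂ) : Matrix ι ι ℂ) ⊗ₖ
      (1 : Matrix (Fin a) (Fin a) ℂ)).mulVec S.vec
  | n + 1 => (((if k < n + 2 then U₁ else U₀ : Matrix.unitaryGroup ι ℂ) : Matrix ι ι ℂ) ⊗ₖ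
      (1 : Matrix (Fin a) (Fin a) ℂ)).mulVec
        ((S.gate n : Matrix (ι × Fin a) (ι × Fin a) ℂ).mulVec (psi S U₀ U₁ k n))

/-- The Gram matrix `G_{ij} = ⟨ψ_i^{(N)}|ψ_j^{(N)}⟩` of the states before the measurement. -/
noncomputable def gram (S : UnitaryStrategy ι a) (U₀ U₁ : Matrix.unitaryGroup ι ℂ) (N : ℕ) :
    Matrix (Fin (N + 1)) (Fin (N + 1)) ℂ :=
  Matrix.of fun i j => star (S.psi U₀ U₁ i (N - 1)) ⬝ᵥ S.psi U₀ U₁ j (N - 1)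

end UnitaryStrategy

/-- `|μ⟩ = ∑_i u^i √c_i |i⟩`. -/
noncomputable def muVec (N : ℕ) (c : ℝ) (u : ℂ) (i : Fin (N + 1)) : ℂ :=
  u ^ (i : ℕ) * (Real.sqrt (cSeq c i) : ℂ)

/-- The matrix `∑_i (1 - t c_i) |i⟩⟨i| + t |μ⟩⟨μ|`. -/
noncomputable def targetGram (N : ℕ) (t c : ℝ) (u : ℂ) :
    Matrix (Fin (N + 1)) (Fin (N + 1)) ℂ :=
  Matrix.diagonal (fun i : Fin (N + 1) => ((1 - t * cSeq c i : ℝ) : ℂ)) +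
    (t : ℂ) • Matrix.vecMulVec (muVec N c u) (star (muVec N c u))

end Unitary

end ChangePoint

/-!
Replacing a single channel `Λ₀` by `Λ₁` moves the change point `i + 1` to `i`. If the channel acts
on the state `ρ`, with marginal `ρ'` on the system, then `|tr (U₀† U₁ ρ')| ≥ t`, because the
numerical range of the normal operator `U₀† U₁` is convex. Everything after this channel acts as a
measurement. Its outcomes `i` and `i + 1` each have probability zero in one of the two cases, so
only the other outcomes contribute to the overlap, and Cauchy-Schwarz gives
`t² ≤ (1 - p_i) (1 - p_{i+1})`. Since the success probabilities of single-use discrimination are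
exactly those allowed by this inequality, both problems are bounded by the same optimization along
a chain, which weighted AM-GM inequalities for neighbouring pairs solve, with weights that depend
on the parity of `N`.

For attainability, subtracting the success probabilities `1 - t c_i` from the diagonal of the
target Gram matrix leaves the positive matrix `t |μ⟩⟨μ|`, so vectors with this Gram matrix can be
identified unambiguously with these probabilities. Such vectors are produced by a sequential
strategy because neighbouring ones have inner product `t u = ⟨φ|U₀† U₁|φ⟩`: unitary gates can
rotate the two possible states back and forth to the input `φ` of the next channel.
-/

namespace ChangePoint

section Functionals

variable {A : Type*} [NonUnitalCStarAlgebra A] [PartialOrder A] [StarOrderedRing A]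

theorem norm_apply_star_mul_sq_le (f : A →ₚ[ℂ] ℂ) (a b : A) :
    ‖f (star a * b)‖ ^ 2 ≤ (f (star a * a)).re * (f (star b * b)).re := by
  have re_eq (x : A) : (f (star x * x)).re = ‖f.toPreGNS x‖ ^ 2 := by
    rw [← Complex.ofReal_re (‖_‖ ^ 2), Complex.ofReal_pow, f.preGNS_norm_sq, f.ofPreGNS_toPreGNS]
  rw [re_eq, re_eq, ← mul_pow]
  gcongr
  exact norm_inner_le_norm (𝕜 := ℂ) (f.toPreGNS a) (f.toPreGNS b)

theorem norm_sum_apply_star_mul_sq_le_of_eq_zero {κ : Type*} [Fintype κ] (f : κ → A →ₚ[ℂ] ℂ)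
    {a b : A} {x y : κ} (hx : (f x (star a * a)).re = 0) (hy : (f y (star b * b)).re = 0) :
    ‖∑ z, f z (star a * b)‖ ^ 2 ≤
      ((∑ z, (f z (star a * a)).re) - (f y (star a * a)).re) *
        ((∑ z, (f z (star b * b)).re) - (f x (star b * b)).re) := by
  classical
  have cauchy_schwarz (z : κ) := norm_apply_star_mul_sq_le (f z) a b
  have re_nonneg (c : A) (z : κ) : 0 ≤ (f z (star c * c)).re :=
    (Complex.nonneg_iff.mp ((f z).map_nonneg (star_mul_self_nonneg c))).1
  have sum_sub (g : κ → ℝ) (w : κ) : ∑ z, g z - g w = ∑ z, Function.update g w 0 z := by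
    rw [Finset.sum_update_of_mem (Finset.mem_univ w), zero_add, sub_eq_iff_eq_add,
      Finset.sdiff_singleton_eq_erase, Finset.sum_erase_add _ _ (Finset.mem_univ w)]
  rw [sum_sub, sum_sub]
  calc ‖∑ z, f z (star a * b)‖ ^ 2 ≤ (∑ z, ‖f z (star a * b)‖) ^ 2 := by
        gcongr; exact norm_sum_le _ _
    _ ≤ _ := Finset.sum_sq_le_sum_mul_sum_of_sq_le_mul _ ?_ ?_ ?_
  · intro z _
    by_cases hz : z = y <;> simp [hz, re_nonneg]
  · intro z _
    by_cases hz : z = x <;> simp [hz, re_nonneg]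
  · intro z _
    rcases eq_or_ne z y with rfl | hzy
    · simpa [hy] using cauchy_schwarz z
    rcases eq_or_ne z x with rfl | hzx
    · simpa [hx] using cauchy_schwarz z
    simpa [hzx, hzy] using cauchy_schwarz z

end Functionals

section NumericalRange

theorem exists_orthonormalBasis_forall_mem {𝕜 E ι : Type*} [RCLike 𝕜] [NormedAddCommGroup E]
    [InnerProductSpace 𝕜 E] [FiniteDimensional 𝕜 E] [DecidableEq ι] {V : ι → Submodule 𝕜 E}
    (hV : DirectSum.IsInternal V)
    (hV' : OrthogonalFamily 𝕜 (fun i => V i) fun i => (V i).subtypeₗᵢ) :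
    ∃ (n : ℕ) (b : OrthonormalBasis (Fin n) 𝕜 E), ∀ k, ∃ i, b k ∈ V i := by
  classical
  have : Fintype {i // V i ≠ ⊥} :=
    (WellFoundedGT.finite_ne_bot_of_iSupIndep hV.submodule_iSupIndep).fintype
  have internal := DirectSum.isInternal_ne_bot_iff.mpr hV
  have orthogonal := hV'.comp (Subtype.val_injective (p := fun i => V i ≠ ⊥))
  exact ⟨_, internal.subordinateOrthonormalBasis rfl orthogonal, fun k =>
    ⟨_, internal.subordinateOrthonormalBasis_subordinate rfl k orthogonal⟩⟩

variable {E : Type*} [NormedAddCommGroup E] [InnerProductSpace ℂ E] [FiniteDimensional ℂ E]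

open Module.End in
theorem exists_orthonormalBasis_forall_apply_eq_smul (T : E →ₗ[ℂ] E) [IsStarNormal T] :
    ∃ (n : ℕ) (b : OrthonormalBasis (Fin n) ℂ E), ∀ i, ∃ μ : ℂ, T (b i) = μ • b i := by
  have hre : (realPart T : E →ₗ[ℂ] E).IsSymmetric :=
    (LinearMap.isSymmetric_iff_isSelfAdjoint _).mpr (realPart T).2
  have him : (imaginaryPart T : E →ₗ[ℂ] E).IsSymmetric :=
    (LinearMap.isSymmetric_iff_isSelfAdjoint _).mpr (imaginaryPart T).2
  have hcomm : Commute (realPart T : E →ₗ[ℂ] E) (imaginaryPart T : E →ₗ[ℂ] E) :=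
    Commute.realPart_imaginaryPart T
  obtain ⟨n, b, hb⟩ := exists_orthonormalBasis_forall_mem
    (hre.directSum_isInternal_of_commute him hcomm)
    (hre.orthogonalFamily_eigenspace_inf_eigenspace him)
  refine ⟨n, b, fun k => ?_⟩
  obtain ⟨⟨β, α⟩, hα, hβ⟩ := hb k
  refine ⟨α + Complex.I * β, ?_⟩
  conv_lhs => rw [← realPart_add_I_smul_imaginaryPart T]
  rw [LinearMap.add_apply, LinearMap.smul_apply, mem_eigenspace_iff.mp hα,
    mem_eigenspace_iff.mp hβ, smul_smul, ← add_smul]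

theorem exists_inner_apply_eq_trace_comp (T σ : E →ₗ[ℂ] E) [IsStarNormal T] (hσ : σ.IsPositive) :
    ∃ φ : E, inner ℂ φ φ = LinearMap.trace ℂ E σ ∧
      inner ℂ φ (T φ) = LinearMap.trace ℂ E (σ ∘ₗ T) := by
  obtain ⟨n, b, hb⟩ := exists_orthonormalBasis_forall_apply_eq_smul T
  choose μ hμ using hb
  let r i : ℂ := (√(inner ℂ (b i) (σ (b i))).re : ℝ)
  have star_mul_r i : star (r i) * r i = inner ℂ (b i) (σ (b i)) := by
    have h := Complex.nonneg_iff.mp (hσ.inner_nonneg_right (b i))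
    rw [RCLike.star_def, Complex.conj_ofReal, ← Complex.ofReal_mul, Real.mul_self_sqrt h.1]
    exact Complex.ext rfl h.2
  refine ⟨∑ i, r i • b i, ?_, ?_⟩
  · rw [b.orthonormal.inner_sum, LinearMap.trace_eq_sum_inner _ b]
    exact Finset.sum_congr rfl fun i _ => star_mul_r i
  · have hT : T (∑ i, r i • b i) = ∑ i, (r i * μ i) • b i := by
      simp only [map_sum, map_smul, hμ, smul_smul]
    rw [hT, b.orthonormal.inner_sum, LinearMap.trace_eq_sum_inner _ b]
    refine Finset.sum_congr rfl fun i _ => ?_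
    rw [LinearMap.comp_apply, hμ, map_smul, inner_smul_right, ← star_mul_r, starRingEnd_apply]
    ring

end NumericalRange

section PartialTrace

variable {R m n a : Type*} [Fintype a]

/-- The partial trace over the second tensor factor, for possibly rectangular matrices. It turns the
state of system and ancilla into the state of the system on which a unitary acts. -/
def partialTrace [AddCommMonoid R] (X : Matrix (m × a) (n × a) R) : Matrix m n R :=
  ∑ x, X.submatrix (fun i => (i, x)) fun j => (j, x)

theorem trace_kronecker_one_mul [NonAssocSemiring R] [Fintype m] [Fintype n] [DecidableEq a]
    (A : Matrix n m R) (X : Matrix (m × a) (n × a) R) :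
    ((A ⊗ₖ (1 : Matrix a a R)) * X).trace = (A * partialTrace X).trace := by
  simp only [Matrix.trace, Matrix.diag, Matrix.mul_apply, partialTrace, Matrix.sum_apply,
    Matrix.submatrix_apply, Fintype.sum_prod_type, Matrix.kroneckerMap_apply, Matrix.one_apply,
    mul_ite, mul_one, mul_zero, ite_mul, zero_mul, Finset.sum_ite_eq, Finset.mem_univ, if_true,
    Finset.mul_sum]
  exact Finset.sum_congr rfl fun i _ => Finset.sum_comm

theorem trace_partialTrace [AddCommMonoid R] [Fintype m] (X : Matrix (m × a) (m × a) R) :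
    (partialTrace X).trace = X.trace := by
  rw [partialTrace, Matrix.trace_sum]
  exact (Fintype.sum_prod_type_right fun p => X p p).symm

theorem posSemidef_partialTrace {X : Matrix (m × a) (m × a) ℂ} (hX : X.PosSemidef) :
    (partialTrace X).PosSemidef :=
  Matrix.posSemidef_sum _ fun _ _ => hX.submatrix _

end PartialTrace

section Overlap

variable {ι : Type*} [Fintype ι]

theorem exists_star_dotProduct_mulVec_eq_trace (T : Matrix ι ι ℂ) [IsStarNormal T]
    {σ : Matrix ι ι ℂ} (hσ : σ.PosSemidef) :
    ∃ φ : ι → ℂ, star φ ⬝ᵥ φ = σ.trace ∧ star φ ⬝ᵥ T.mulVec φ = (T * σ).trace := by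
  classical
  have : IsStarNormal (Matrix.toEuclideanLin T) := by
    refine ⟨?_⟩
    rw [LinearMap.star_eq_adjoint, ← Matrix.toEuclideanLin_conjTranspose_eq_adjoint]
    have h := congrArg Matrix.toEuclideanLin (star_comm_self' T)
    rwa [Matrix.toLpLin_mul_same, Matrix.toLpLin_mul_same] at h
  obtain ⟨φ, h₁, h₂⟩ := exists_inner_apply_eq_trace_comp (Matrix.toEuclideanLin T)
    (Matrix.toEuclideanLin σ) (Matrix.isPositive_toEuclideanLin_iff.mpr hσ)
  have trace_eq (A : Matrix ι ι ℂ) :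
      LinearMap.trace ℂ (EuclideanSpace ℂ ι) (Matrix.toEuclideanLin A) = A.trace := by
    rw [Matrix.toEuclideanLin_eq_toLin_orthonormal, Matrix.trace_toLin_eq]
  rw [← Matrix.toLpLin_mul_same, trace_eq, Matrix.trace_mul_comm] at h₂
  rw [trace_eq] at h₁
  refine ⟨φ.ofLp, ?_, ?_⟩
  · rw [← h₁, EuclideanSpace.inner_eq_star_dotProduct, dotProduct_comm]
  · rw [← h₂, EuclideanSpace.inner_eq_star_dotProduct, dotProduct_comm, Matrix.ofLp_toLpLin,
      Matrix.toLin'_apply]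

theorem star_dotProduct_self_eq_norm_sq {𝕜 m : Type*} [RCLike 𝕜] [Fintype m] (v : m → 𝕜) :
    star v ⬝ᵥ v = (‖WithLp.toLp 2 v‖ : 𝕜) ^ 2 := by
  rw [← inner_self_eq_norm_sq_to_K (𝕜 := 𝕜), EuclideanSpace.inner_eq_star_dotProduct,
    dotProduct_comm]

variable [DecidableEq ι]

theorem overlapValues_eq_image_sphere (U₀ U₁ : Matrix.unitaryGroup ι ℂ) :
    overlapValues U₀ U₁ =
      (fun φ : EuclideanSpace ℂ ι => ‖overlap U₀ U₁ φ.ofLp‖) '' Metric.sphere 0 1 := by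
  have unit_iff (φ : ι → ℂ) : star φ ⬝ᵥ φ = 1 ↔ ‖WithLp.toLp 2 φ‖ = 1 := by
    rw [star_dotProduct_self_eq_norm_sq, ← sq_eq_sq₀ (norm_nonneg _) zero_le_one, one_pow]
    norm_cast
    exact Complex.ofReal_eq_one
  ext r
  constructor
  · rintro ⟨φ, hφ, rfl⟩
    exact ⟨WithLp.toLp 2 φ, mem_sphere_zero_iff_norm.mpr ((unit_iff φ).mp hφ), rfl⟩
  · rintro ⟨φ, hφ, rfl⟩
    exact ⟨φ.ofLp, (unit_iff _).mpr (mem_sphere_zero_iff_norm.mp hφ), rfl⟩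

theorem isLeast_overlapValues [Nonempty ι] (U₀ U₁ : Matrix.unitaryGroup ι ℂ) :
    IsLeast (overlapValues U₀ U₁) (minOverlap U₀ U₁) := by
  have compact : IsCompact (overlapValues U₀ U₁) := by
    rw [overlapValues_eq_image_sphere]
    exact (isCompact_sphere _ _).image (by unfold overlap; fun_prop)
  refine compact.isLeast_sInf ?_
  rw [overlapValues_eq_image_sphere]
  exact (NormedSpace.sphere_nonempty.mpr zero_le_one).image _

theorem minOverlap_nonneg (U₀ U₁ : Matrix.unitaryGroup ι ℂ) : 0 ≤ minOverlap U₀ U₁ :=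
  Real.sInf_nonneg fun _ ⟨_, _, h⟩ => h ▸ norm_nonneg _

theorem minOverlap_le_norm_trace [Nonempty ι] (U₀ U₁ : Matrix.unitaryGroup ι ℂ)
    {a : Type*} [Fintype a] [DecidableEq a] (ρ : DensityMatrix (ι × a)) :
    minOverlap U₀ U₁ ≤ ‖(((U₁ : Matrix ι ι ℂ) ⊗ₖ (1 : Matrix a a ℂ)) * ρ.mat *
      ((U₀ : Matrix ι ι ℂ) ⊗ₖ (1 : Matrix a a ℂ)).conjTranspose).trace‖ := by
  have hU : IsStarNormal ((U₀ : Matrix ι ι ℂ).conjTranspose * (U₁ : Matrix ι ι ℂ)) :=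
    inferInstanceAs (IsStarNormal ((star U₀ * U₁ : Matrix.unitaryGroup ι ℂ) : Matrix ι ι ℂ))
  obtain ⟨φ, hφ, h⟩ := exists_star_dotProduct_mulVec_eq_trace
    ((U₀ : Matrix ι ι ℂ).conjTranspose * (U₁ : Matrix ι ι ℂ)) (posSemidef_partialTrace ρ.posSemidef)
  rw [trace_partialTrace, ρ.trace_eq_one] at hφ
  refine (isLeast_overlapValues U₀ U₁).2 ⟨φ, hφ, ?_⟩
  rw [Matrix.trace_mul_comm, ← mul_assoc, Matrix.conjTranspose_kronecker, Matrix.conjTranspose_one,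
    ← Matrix.mul_kronecker_mul, one_mul, trace_kronecker_one_mul]
  exact congrArg norm h

end Overlap

section Channels

variable {l m n a : Type*} [Fintype l] [Fintype m] [Fintype n]

theorem Channel.posSemidef_ampliation [Finite a] (Φ : Channel m n) {X : Matrix (m × a) (m × a) ℂ}
    (hX : X.PosSemidef) : (ampliation a Φ.map X).PosSemidef := by
  let e := Finite.equivFin a
  have h := (Φ.completelyPositive _ _ (hX.submatrix (Prod.map id e.symm))).submatrix (Prod.map id e)
  convert h using 1
  ext p q
  simp [ampliation]

theorem Channel.posSemidef_map (Φ : Channel m n) {X : Matrix m m ℂ} (hX : X.PosSemidef) :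
    (Φ.map X).PosSemidef :=
  (Φ.posSemidef_ampliation (hX.submatrix Prod.fst)).submatrix fun i => (i, ())

theorem Channel.trace_ampliation [Fintype a] (Φ : Channel m n) (X : Matrix (m × a) (m × a) ℂ) :
    (ampliation a Φ.map X).trace = X.trace := by
  simp only [Matrix.trace, Matrix.diag, Fintype.sum_prod_type_right]
  exact Finset.sum_congr rfl fun x _ => Φ.tracePreserving (Matrix.of fun i j => X (i, x) (j, x))

/-- The identity channel, for the steps at which a strategy does nothing. -/
def Channel.id (m : Type*) [Fintype m] : Channel m m where
  map := LinearMap.id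
  completelyPositive _ _ hX := hX
  tracePreserving _ := rfl

/-- Composition of channels: `Φ` acts first, then `Ψ`, as for functions. -/
def Channel.comp (Ψ : Channel m n) (Φ : Channel l m) : Channel l n where
  map := Ψ.map ∘ₗ Φ.map
  completelyPositive k X hX := Ψ.completelyPositive k _ (Φ.completelyPositive k X hX)
  tracePreserving X := (Ψ.tracePreserving _).trans (Φ.tracePreserving X)

/-- The channel `Φ ⊗ id_a`, which lets `Φ` act on one part of a composite system. -/
def Channel.ampliate (a : Type*) [Fintype a] (Φ : Channel m n) : Channel (m × a) (n × a) where
  map :=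
    { toFun := ampliation a Φ.map
      map_add' := fun X Y => by
        ext p q
        exact congrFun₂ (Φ.map.map_add (Matrix.of fun i j => X (i, p.2) (j, q.2))
          (Matrix.of fun i j => Y (i, p.2) (j, q.2))) p.1 q.1
      map_smul' := fun z X => by
        ext p q
        exact congrFun₂ (Φ.map.map_smul z (Matrix.of fun i j => X (i, p.2) (j, q.2))) p.1 q.1 }
  completelyPositive k X hX :=
    (Φ.posSemidef_ampliation (hX.submatrix (Equiv.prodAssoc m a (Fin k)).symm)).submatrix
      (Equiv.prodAssoc n a (Fin k))
  tracePreserving := Φ.trace_ampliation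

/-- The output state of a channel for a given input state. -/
def Channel.apply (Φ : Channel m n) (ρ : DensityMatrix m) : DensityMatrix n where
  mat := Φ.map ρ.mat
  posSemidef := Φ.posSemidef_map ρ.posSemidef
  trace_eq_one := (Φ.tracePreserving _).trans ρ.trace_eq_one

end Channels

theorem exists_eq_conjTranspose_mul_self {m : Type*} [Fintype m] {A : Matrix m m ℂ}
    (hA : A.PosSemidef) : ∃ R : Matrix m m ℂ, A = R.conjTranspose * R := by
  classical
  open scoped MatrixOrder Matrix.Norms.L2Operator in
  exact CStarAlgebra.nonneg_iff_eq_star_mul_self.mp hA.nonneg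

theorem trace_mul_nonneg {m : Type*} [Fintype m] {A X : Matrix m m ℂ}
    (hA : A.PosSemidef) (hX : X.PosSemidef) : 0 ≤ (A * X).trace := by
  obtain ⟨R, rfl⟩ := exists_eq_conjTranspose_mul_self hA
  rw [mul_assoc, Matrix.trace_mul_comm]
  exact (hX.mul_mul_conjTranspose_same R).trace_nonneg

theorem ampliation_unitaryChannel {m a : Type*} [Fintype m] [DecidableEq m] [Fintype a]
    [DecidableEq a] (U : Matrix.unitaryGroup m ℂ) (X : Matrix (m × a) (m × a) ℂ) :
    ampliation a (unitaryChannel U).map X = ((U : Matrix m m ℂ) ⊗ₖ (1 : Matrix a a ℂ)) * X *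
      ((U : Matrix m m ℂ) ⊗ₖ (1 : Matrix a a ℂ)).conjTranspose :=
  conj_ampliation _ _ (fun _ => rfl) X

section Measurements

variable {κ m n : Type*} [Fintype κ] [Fintype m] [Fintype n] [DecidableEq n]

theorem POVM.sum_trace_elem_mul (M : POVM κ n) (X : Matrix n n ℂ) :
    ∑ z, (M.elem z * X).trace = X.trace := by
  rw [← Matrix.trace_sum, ← Finset.sum_mul, M.sum_eq_one, one_mul]

open scoped MatrixOrder Matrix.Norms.L2Operator in
theorem POVM.norm_trace_conjTranspose_mul_sq_le (M : POVM κ n) (Φ : Channel m n)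
    {A B : Matrix m m ℂ} {x y : κ}
    (hx : (M.elem x * Φ.map (A.conjTranspose * A)).trace.re = 0)
    (hy : (M.elem y * Φ.map (B.conjTranspose * B)).trace.re = 0) :
    ‖(A.conjTranspose * B).trace‖ ^ 2 ≤
      ((A.conjTranspose * A).trace.re - (M.elem y * Φ.map (A.conjTranspose * A)).trace.re) *
        ((B.conjTranspose * B).trace.re - (M.elem x * Φ.map (B.conjTranspose * B)).trace.re) := by
  classical
  let f (z : κ) : Matrix m m ℂ →ₚ[ℂ] ℂ := .mk₀
    (Matrix.traceLinearMap n ℂ ℂ ∘ₗ LinearMap.mulLeft ℂ (M.elem z) ∘ₗ Φ.map) fun X hX =>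
      trace_mul_nonneg (M.posSemidef z) (Φ.posSemidef_map (Matrix.nonneg_iff_posSemidef.mp hX))
  have sum_f (X : Matrix m m ℂ) : ∑ z, f z X = X.trace :=
    (M.sum_trace_elem_mul _).trans (Φ.tracePreserving X)
  have key := norm_sum_apply_star_mul_sq_le_of_eq_zero f (a := A) (b := B) (x := x) (y := y) hx hy
  rwa [sum_f, ← Complex.re_sum, sum_f, ← Complex.re_sum, sum_f] at key

end Measurements

namespace Tester

variable {V W κ : Type*} [Fintype V] [Fintype W] [DecidableEq W] [Fintype κ] {N : ℕ}
  (T : Tester V W N κ)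

/-- The state of `V ⊗ ancilla` that is fed into the `(n+1)`-st channel of the process `E`. -/
def inputState (E : ℕ → Channel V W) : (n : ℕ) → DensityMatrix (V × Fin (T.anc n))
  | 0 => T.init
  | n + 1 => (T.interm n).apply (((E (n + 1)).ampliate _).apply (inputState E n))

theorem stateAfter_eq_apply_inputState (E : ℕ → Channel V W) (n : ℕ) :
    T.stateAfter E n = (((E (n + 1)).ampliate _).apply (T.inputState E n)).mat := by
  induction n with
  | zero => rfl
  | succ n ih => rw [stateAfter, ih]; rfl

theorem inputState_congr {E F : ℕ → Channel V W} {n : ℕ} (h : ∀ i ≤ n, E i = F i) :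
    T.inputState E n = T.inputState F n := by
  induction n with
  | zero => rfl
  | succ n ih => rw [inputState, inputState, ih fun i hi => h i (hi.trans n.le_succ), h _ le_rfl]

theorem exists_stateAfter_eq_map (E : ℕ → Channel V W) {s n : ℕ} (hsn : s ≤ n) :
    ∃ Φ : Channel (W × Fin (T.anc s)) (W × Fin (T.anc n)),
      ∀ F : ℕ → Channel V W, (∀ i > s + 1, F i = E i) →
        T.stateAfter F n = Φ.map (T.stateAfter F s) := by
  induction n, hsn using Nat.le_induction with
  | base => exact ⟨.id _, fun _ _ => rfl⟩
  | succ n hsn ih =>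
    obtain ⟨Φ, hΦ⟩ := ih
    refine ⟨((E (n + 2)).ampliate _).comp ((T.interm n).comp Φ), fun F hF => ?_⟩
    rw [stateAfter, hΦ F hF, hF (n + 2) (by omega)]
    rfl

theorem exists_stateAfter_update_eq_map (E : ℕ → Channel V W) {s n : ℕ} (hsn : s ≤ n) :
    ∃ (ρ : DensityMatrix (V × Fin (T.anc s))) (Φ : Channel (W × Fin (T.anc s)) (W × Fin (T.anc n))),
      ∀ Λ : Channel V W, T.stateAfter (Function.update E (s + 1) Λ) n =
        Φ.map (ampliation _ Λ.map ρ.mat) := by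
  obtain ⟨Φ, hΦ⟩ := T.exists_stateAfter_eq_map E hsn
  refine ⟨T.inputState E s, Φ, fun Λ => ?_⟩
  have inputState_eq : T.inputState (Function.update E (s + 1) Λ) s = T.inputState E s :=
    T.inputState_congr fun i hi => Function.update_of_ne (by omega) _ _
  rw [hΦ _ fun i hi => Function.update_of_ne hi.ne' _ _, stateAfter_eq_apply_inputState,
    Function.update_self, inputState_eq]
  rfl

theorem prob_nonneg (E : ℕ → Channel V W) (x : κ) : 0 ≤ T.prob E x := by
  rw [prob, stateAfter_eq_apply_inputState]
  exact (Complex.nonneg_iff.mp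
    (trace_mul_nonneg (T.meas.posSemidef x) (DensityMatrix.posSemidef _))).1

theorem sum_prob (E : ℕ → Channel V W) : ∑ x, T.prob E x = 1 := by
  simp only [prob]
  rw [← Complex.re_sum, T.meas.sum_trace_elem_mul, stateAfter_eq_apply_inputState,
    DensityMatrix.trace_eq_one, Complex.one_re]

theorem prob_le_one (E : ℕ → Channel V W) (x : κ) : T.prob E x ≤ 1 := by
  rw [← T.sum_prob E]
  exact Finset.single_le_sum (fun y _ => T.prob_nonneg E y) (Finset.mem_univ x)

theorem minOverlap_sq_le {ι : Type*} [Fintype ι] [DecidableEq ι] [Nonempty ι] (T : Tester ι ι N κ)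
    (E : ℕ → Channel ι ι) (U₀ U₁ : Matrix.unitaryGroup ι ℂ) {s : ℕ} (hs : s < N) {x y : κ}
    (hx : T.prob (Function.update E (s + 1) (unitaryChannel U₁)) x = 0)
    (hy : T.prob (Function.update E (s + 1) (unitaryChannel U₀)) y = 0) :
    minOverlap U₀ U₁ ^ 2 ≤
      (1 - T.prob (Function.update E (s + 1) (unitaryChannel U₀)) x) *
        (1 - T.prob (Function.update E (s + 1) (unitaryChannel U₁)) y) := by
  obtain ⟨ρ, Φ, hΦ⟩ := T.exists_stateAfter_update_eq_map E (Nat.le_sub_one_of_lt hs)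
  obtain ⟨S, hS⟩ := exists_eq_conjTranspose_mul_self ρ.posSemidef
  let A (U : Matrix.unitaryGroup ι ℂ) := S * ((U : Matrix ι ι ℂ) ⊗ₖ
    (1 : Matrix (Fin (T.anc s)) (Fin (T.anc s)) ℂ)).conjTranspose
  have conjTranspose_A_mul_A (U U' : Matrix.unitaryGroup ι ℂ) : (A U).conjTranspose * A U' =
      ((U : Matrix ι ι ℂ) ⊗ₖ 1) * ρ.mat * ((U' : Matrix ι ι ℂ) ⊗ₖ 1).conjTranspose := by
    simp only [A, hS, Matrix.conjTranspose_mul, Matrix.conjTranspose_conjTranspose, mul_assoc]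
  have ampliation_eq (U : Matrix.unitaryGroup ι ℂ) :
      ampliation _ (unitaryChannel U).map ρ.mat = (A U).conjTranspose * A U := by
    rw [conjTranspose_A_mul_A, ampliation_unitaryChannel]
  have trace_eq_one (U : Matrix.unitaryGroup ι ℂ) : ((A U).conjTranspose * A U).trace.re = 1 := by
    rw [← ampliation_eq, Channel.trace_ampliation, ρ.trace_eq_one, Complex.one_re]
  simp only [prob, hΦ, ampliation_eq] at hx hy ⊢
  have key := T.meas.norm_trace_conjTranspose_mul_sq_le Φ hx hy
  rw [trace_eq_one, trace_eq_one, conjTranspose_A_mul_A, mul_comm] at key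
  exact (pow_le_pow_left₀ (minOverlap_nonneg U₀ U₁) (minOverlap_le_norm_trace U₀ U₁ ρ) 2).trans key

end Tester

section Factorization

variable {𝕜 F G H κ : Type*} [RCLike 𝕜] [AddCommGroup F] [Module 𝕜 F]
  [NormedAddCommGroup G] [InnerProductSpace 𝕜 G] [NormedAddCommGroup H] [InnerProductSpace 𝕜 H]

theorem exists_contraction_comp_eq_of_norm_le (A : F →ₗ[𝕜] H) (B : F →ₗ[𝕜] G)
    [(LinearMap.range A).HasOrthogonalProjection] (h : ∀ x, ‖B x‖ ≤ ‖A x‖) :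
    ∃ C : H →ₗ[𝕜] G, C ∘ₗ A = B ∧ ∀ y, ‖C y‖ ≤ ‖y‖ := by
  obtain ⟨s, hs⟩ := A.rangeRestrict.exists_rightInverse_of_surjective A.range_rangeRestrict
  have apply_s (y : LinearMap.range A) : A (s y) = y :=
    congrArg Subtype.val (LinearMap.congr_fun hs y)
  refine ⟨B ∘ₗ s ∘ₗ (LinearMap.range A).orthogonalProjectionOnto, LinearMap.ext fun x => ?_,
    fun y => ?_⟩
  · have proj_eq : (LinearMap.range A).orthogonalProjectionOnto (A x) = A.rangeRestrict x :=
      Submodule.orthogonalProjectionOnto_mem_subspace_eq_self (A.rangeRestrict x)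
    have norm_le : ‖B (s (A.rangeRestrict x) - x)‖ ≤ 0 := by
      refine (h _).trans_eq ?_
      rw [map_sub, apply_s]
      exact norm_eq_zero.mpr (sub_self _)
    rw [norm_le_zero_iff, map_sub, sub_eq_zero, ← proj_eq] at norm_le
    exact norm_le
  · refine (h _).trans ?_
    rw [LinearMap.comp_apply, apply_s]
    exact Submodule.norm_orthogonalProjectionOnto_apply_le _ y

theorem norm_sq_sum_smul_eq [Fintype κ] (v : κ → H) (x : κ → 𝕜) :
    ((‖∑ i, x i • v i‖ ^ 2 : ℝ) : 𝕜) = star x ⬝ᵥ (Matrix.gram 𝕜 v).mulVec x := by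
  rw [Matrix.star_dotProduct_gram_mulVec, inner_self_eq_norm_sq_to_K, RCLike.ofReal_pow]

variable [Finite κ]

theorem exists_contraction_apply_eq_of_posSemidef_gram_sub {v : κ → H} {w : κ → G}
    (h : (Matrix.gram 𝕜 v - Matrix.gram 𝕜 w).PosSemidef) :
    ∃ C : H →ₗ[𝕜] G, (∀ i, C (v i) = w i) ∧ ∀ y, ‖C y‖ ≤ ‖y‖ := by
  classical
  have := Fintype.ofFinite κ
  obtain ⟨C, hC, hC'⟩ := exists_contraction_comp_eq_of_norm_le (Fintype.linearCombination 𝕜 v)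
    (Fintype.linearCombination 𝕜 w) fun x => by
      have nonneg := h.dotProduct_mulVec_nonneg x
      rw [Matrix.sub_mulVec, dotProduct_sub, ← norm_sq_sum_smul_eq, ← norm_sq_sum_smul_eq,
        sub_nonneg, RCLike.ofReal_le_ofReal] at nonneg
      exact le_of_sq_le_sq nonneg (norm_nonneg _)
  refine ⟨C, fun i => ?_, hC'⟩
  simpa using LinearMap.congr_fun hC (Pi.single i 1)

variable [FiniteDimensional 𝕜 H]

theorem exists_linearIsometryEquiv_apply_eq_of_gram_eq {v w : κ → H}
    (h : Matrix.gram 𝕜 v = Matrix.gram 𝕜 w) : ∃ C : H ≃ₗᵢ[𝕜] H, ∀ i, C (v i) = w i := by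
  have := Fintype.ofFinite κ
  obtain ⟨C, hC, -⟩ := exists_contraction_apply_eq_of_posSemidef_gram_sub (v := v) (w := w)
    (by rw [h, sub_self]; exact .zero)
  let L : Submodule.span 𝕜 (Set.range v) →ₗᵢ[𝕜] H :=
    { toLinearMap := C ∘ₗ Submodule.subtype _
      norm_map' := by
        rintro ⟨y, hy⟩
        obtain ⟨x, rfl⟩ := (Submodule.mem_span_range_iff_exists_fun 𝕜).mp hy
        have norm_sq_eq := norm_sq_sum_smul_eq w x
        rw [← h, ← norm_sq_sum_smul_eq, RCLike.ofReal_inj] at norm_sq_eq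
        simpa [hC] using (sq_eq_sq₀ (norm_nonneg _) (norm_nonneg _)).mp norm_sq_eq }
  refine ⟨L.extend.toLinearIsometryEquiv rfl, fun i => ?_⟩
  exact (L.extend_apply ⟨v i, Submodule.subset_span ⟨i, rfl⟩⟩).trans (hC i)

end Factorization

section Matrices

variable {𝕜 κ l m : Type*} [RCLike 𝕜] [Fintype m]

theorem star_mulVec_dotProduct_mulVec [Fintype l] (A B : Matrix l m 𝕜) (v w : m → 𝕜) :
    star (A.mulVec v) ⬝ᵥ B.mulVec w = star v ⬝ᵥ (A.conjTranspose * B).mulVec w := by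
  rw [Matrix.star_mulVec, ← Matrix.dotProduct_mulVec, Matrix.mulVec_mulVec]

theorem gram_toLp (v : κ → m → 𝕜) :
    Matrix.gram 𝕜 (fun i => WithLp.toLp 2 (v i)) = Matrix.of fun i j => star (v i) ⬝ᵥ v j := by
  ext i j
  rw [Matrix.gram_apply, EuclideanSpace.inner_toLp_toLp, dotProduct_comm, Matrix.of_apply]

variable [DecidableEq m]

theorem star_unitary_mulVec_dotProduct (U : Matrix.unitaryGroup m 𝕜) (v w : m → 𝕜) :
    star ((U : Matrix m m 𝕜).mulVec v) ⬝ᵥ (U : Matrix m m 𝕜).mulVec w = star v ⬝ᵥ w := by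
  rw [star_mulVec_dotProduct_mulVec, ← Matrix.star_eq_conjTranspose,
    Matrix.UnitaryGroup.star_mul_self, Matrix.one_mulVec]

theorem exists_unitary_mulVec_eq [Finite κ] {v w : κ → m → 𝕜}
    (h : ∀ i j, star (v i) ⬝ᵥ v j = star (w i) ⬝ᵥ w j) :
    ∃ W : Matrix.unitaryGroup m 𝕜, ∀ i, (W : Matrix m m 𝕜).mulVec (v i) = w i := by
  obtain ⟨C, hC⟩ := exists_linearIsometryEquiv_apply_eq_of_gram_eq (𝕜 := 𝕜)
    (v := fun i => WithLp.toLp 2 (v i)) (w := fun i => WithLp.toLp 2 (w i))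
    (by rw [gram_toLp, gram_toLp]; simp only [h])
  let e := (Matrix.toEuclideanCLM (n := m) (𝕜 := 𝕜)).symm
  refine ⟨⟨e (Unitary.linearIsometryEquiv.symm C), ?_⟩, fun i => ?_⟩
  · exact Unitary.map_mem e (Unitary.linearIsometryEquiv.symm C).2
  · have apply_eq := Matrix.ofLp_toEuclideanCLM (e (Unitary.linearIsometryEquiv.symm C))
      (WithLp.toLp 2 (v i))
    rw [← apply_eq, StarAlgEquiv.apply_symm_apply]
    exact congrArg WithLp.ofLp (hC i)

theorem posSemidef_one_sub_conjTranspose_mul_self [Fintype l] {K : Matrix l m 𝕜}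
    (hK : ∀ x, ‖K.toEuclideanLin x‖ ≤ ‖x‖) : (1 - K.conjTranspose * K).PosSemidef := by
  refine .of_dotProduct_mulVec_nonneg
    (Matrix.isHermitian_one.sub (Matrix.isHermitian_conjTranspose_mul_self K)) fun x => ?_
  rw [Matrix.sub_mulVec, dotProduct_sub, Matrix.one_mulVec, ← star_mulVec_dotProduct_mulVec,
    star_dotProduct_self_eq_norm_sq, star_dotProduct_self_eq_norm_sq, sub_nonneg]
  norm_cast
  exact pow_le_pow_left₀ (norm_nonneg _) (hK (WithLp.toLp 2 x)) 2

end Matrices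

section Unambiguous

variable {κ m : Type*} [Fintype κ] [Fintype m] [DecidableEq m]

/-- The measurement whose conclusive outcomes are the rank-one operators `|k_j⟩⟨k_j|`, where
`⟨k_j|` are the rows of a contraction `K`. -/
def POVM.ofContraction (K : Matrix κ m ℂ) (hK : (1 - K.conjTranspose * K).PosSemidef) :
    POVM (Option κ) m where
  elem x := x.elim (1 - K.conjTranspose * K) fun j => Matrix.vecMulVec (star (K j)) (K j)
  posSemidef
    | none => hK
    | some j => by simpa using Matrix.posSemidef_vecMulVec_self_star (star (K j))
  sum_eq_one := by
    rw [Fintype.sum_option, Option.elim, sub_add_eq_add_sub, sub_eq_iff_eq_add, add_right_inj]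
    ext x y
    simp [Matrix.sum_apply, Matrix.vecMulVec_apply, Matrix.mul_apply]

theorem exists_povm_of_posSemidef_gram_sub_diagonal [DecidableEq κ] (ψ : κ → m → ℂ) {p : κ → ℝ}
    (hp : ∀ j, 0 ≤ p j)
    (h : ((Matrix.of fun i j => star (ψ i) ⬝ᵥ ψ j) -
      Matrix.diagonal fun i => (p i : ℂ)).PosSemidef) :
    ∃ M : POVM (Option κ) m, ∀ i j,
      star (ψ i) ⬝ᵥ (M.elem (some j)).mulVec (ψ i) = if i = j then (p j : ℂ) else 0 := by
  have sqrt_mul_sqrt (j : κ) : ((√(p j) : ℝ) : ℂ) * (√(p j) : ℝ) = p j := by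
    rw [← Complex.ofReal_mul, Real.mul_self_sqrt (hp j)]
  let w (i : κ) : κ → ℂ := Pi.single i (√(p i) : ℝ)
  have gram_w : (Matrix.of fun i j => star (w i) ⬝ᵥ w j) = Matrix.diagonal fun i => (p i : ℂ) := by
    ext i j
    rcases eq_or_ne i j with rfl | hij
    · simp [w, sqrt_mul_sqrt]
    · simp [w, hij]
  rw [← gram_w, ← gram_toLp, ← gram_toLp] at h
  obtain ⟨C, hC, hC'⟩ := exists_contraction_apply_eq_of_posSemidef_gram_sub h
  obtain ⟨K, rfl⟩ := Matrix.toEuclideanLin.surjective C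
  have K_dotProduct (i j : κ) : K j ⬝ᵥ ψ i = w i j := congrArg (fun v => v.ofLp j) (hC i)
  refine ⟨.ofContraction K (posSemidef_one_sub_conjTranspose_mul_self hC'), fun i j => ?_⟩
  have star_dotProduct : star (ψ i) ⬝ᵥ star (K j) = star (w i j) := by
    rw [← K_dotProduct, Matrix.star_dotProduct_star]
  simp only [POVM.ofContraction, Option.elim, Matrix.vecMulVec_mulVec, dotProduct_smul,
    K_dotProduct, star_dotProduct]
  rcases eq_or_ne i j with rfl | hij
  · simp [w, sqrt_mul_sqrt]
  · simp [w, hij]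

end Unambiguous

section ChainOptimization

theorem cSeq_pos {c : ℝ} (hc : 0 < c) (i : ℕ) : 0 < cSeq c i := by
  unfold cSeq
  split_ifs <;> positivity

theorem cSeq_mul_cSeq_succ {c : ℝ} (hc : c ≠ 0) (i : ℕ) : cSeq c i * cSeq c (i + 1) = 1 := by
  by_cases h : Even i <;> simp [cSeq, h, Nat.even_add_one, hc]

theorem mul_cSeq_le_one {t c : ℝ} (htc : t ≤ c) (hc : 0 < c) (hc1 : c ≤ 1) (i : ℕ) :
    t * cSeq c i ≤ 1 := by
  unfold cSeq
  split_ifs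
  · exact mul_le_one₀ (htc.trans hc1) hc.le hc1
  · exact (mul_inv_le_iff₀ hc).mpr (by rwa [one_mul])

variable {t : ℝ} {N m : ℕ}

theorem cParam_of_odd (t : ℝ) (hN : Odd N) : cParam t N = 1 := if_pos hN

theorem cParam_two_mul (t : ℝ) (m : ℕ) : cParam t (2 * m) = max t √(m / (m + 1)) := by
  rw [cParam, if_neg (by simp)]
  push_cast
  rw [show (2 * (m : ℝ) + 2) = 2 * (m + 1) by ring, mul_div_mul_left _ _ two_ne_zero]

theorem cParam_le_one (ht : t ≤ 1) (N : ℕ) : cParam t N ≤ 1 := by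
  unfold cParam
  split_ifs
  · exact le_rfl
  · refine max_le ht (Real.sqrt_le_one.mpr ?_)
    rw [div_le_one (by positivity)]
    linarith

theorem le_cParam (ht : t ≤ 1) (N : ℕ) : t ≤ cParam t N := by
  unfold cParam
  split_ifs
  · exact ht
  · exact le_max_left _ _

theorem cParam_pos (t : ℝ) (hN : 1 ≤ N) : 0 < cParam t N := by
  unfold cParam
  split_ifs
  · exact one_pos
  · exact lt_max_of_lt_right (by positivity)

theorem le_cParam_sq_mul (t : ℝ) (m : ℕ) : (m : ℝ) ≤ cParam t (2 * m) ^ 2 * (m + 1) := by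
  rw [← div_le_iff₀ (by positivity), cParam_two_mul]
  exact (Real.sqrt_le_iff.mp (le_max_right _ _)).2

theorem cParam_eq_or_cParam_sq_mul_eq (t : ℝ) (m : ℕ) :
    cParam t (2 * m) = t ∨ cParam t (2 * m) ^ 2 * (m + 1) = m := by
  rw [cParam_two_mul]
  refine (max_choice t √(m / (m + 1))).imp id fun h => ?_
  rw [h, Real.sq_sqrt (by positivity), div_mul_cancel₀ _ (by positivity)]

theorem sum_range_two_mul {M : Type*} [AddCommMonoid M] (x : ℕ → M) (m : ℕ) :
    ∑ i ∈ Finset.range (2 * m), x i = ∑ j ∈ Finset.range m, (x (2 * j) + x (2 * j + 1)) := by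
  induction m with
  | zero => simp
  | succ m ih =>
    rw [Nat.mul_succ, Finset.sum_range_succ, Finset.sum_range_succ, ih, Finset.sum_range_succ,
      add_assoc]

theorem sum_cSeq_cParam (t : ℝ) (N : ℕ) :
    ∑ i ∈ Finset.range (N + 1), cSeq (cParam t N) i
      = ((N + 2) * cParam t N + N * (cParam t N)⁻¹) / 2 := by
  rcases Nat.even_or_odd' N with ⟨m, rfl | rfl⟩
  · rw [Finset.sum_range_succ, sum_range_two_mul]
    simp only [cSeq, even_two, Even.mul_right, ↓reduceIte, Nat.not_even_bit1, Finset.sum_const,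
      Finset.card_range, smul_add, nsmul_eq_mul, Nat.cast_mul, Nat.cast_ofNat]
    ring
  · rw [cParam_of_odd t (odd_two_mul_add_one m)]
    simp only [cSeq, inv_one, ite_self, Finset.sum_const, Finset.card_range, nsmul_eq_mul,
      Nat.cast_add, Nat.cast_mul, Nat.cast_ofNat, Nat.cast_one, mul_one]
    ring

/-- The average success probability when the change point `i` is identified with probability
`1 - t c_i`, for the parameter `c` of the optimal strategy. -/
noncomputable def optimalAverage (t : ℝ) (N : ℕ) : ℝ :=
  (∑ i : Fin (N + 1), (1 - t * cSeq (cParam t N) i)) / (N + 1)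

theorem optimalAverage_eq (t : ℝ) (N : ℕ) :
    optimalAverage t N
      = 1 - t * (((N + 2) * cParam t N + N * (cParam t N)⁻¹) / (2 * (N + 1))) := by
  rw [optimalAverage, Finset.sum_sub_distrib, ← Finset.mul_sum,
    Fin.sum_univ_eq_sum_range (fun i => cSeq (cParam t N) i), sum_cSeq_cParam]
  simp only [Finset.sum_const, Finset.card_univ, Fintype.card_fin, nsmul_eq_mul, Nat.cast_add,
    Nat.cast_one, mul_one]
  field_simp

theorem two_mul_mul_le_add_sq_mul {a b s : ℝ} (c : ℝ) (ha : 0 ≤ a) (hb : 0 ≤ b)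
    (h : s ^ 2 ≤ a * b) : 2 * (c * s) ≤ a + c ^ 2 * b := by
  refine le_of_sq_le_sq ?_ (by positivity)
  linear_combination 4 * c ^ 2 * h + sq_nonneg (a - c ^ 2 * b)

-- The pairs `(2j, 2j+1)` and `(2j+1, 2j+2)` get the weights `m - j` and `1 + j`, so that for
-- `k = m` every `x i` has total weight `m` if `i` is even, and `m + 1` if `i` is odd.
theorem sum_chain_pairs (x : ℕ → ℝ) (d m : ℝ) (k : ℕ) :
    ∑ j ∈ Finset.range k, ((m - j) * (x (2 * j) + d * x (2 * j + 1))
        + (1 + j) * (x (2 * j + 2) + d * x (2 * j + 1)))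
      = m * ∑ j ∈ Finset.range k, x (2 * j) + k * x (2 * k)
        + d * (m + 1) * ∑ j ∈ Finset.range k, x (2 * j + 1) := by
  induction k with
  | zero => simp
  | succ k ih =>
    rw [Finset.sum_range_succ, ih, Finset.sum_range_succ, Finset.sum_range_succ, Nat.mul_succ]
    push_cast
    ring

theorem le_even_sum_add_odd_sum (c : ℝ) {x : ℕ → ℝ} (hx : ∀ i ≤ 2 * m, 0 ≤ x i)
    (h : ∀ i < 2 * m, t ^ 2 ≤ x i * x (i + 1)) :
    m * ((m + 1) * (2 * (c * t))) ≤ m * ∑ j ∈ Finset.range (m + 1), x (2 * j)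
      + c ^ 2 * (m + 1) * ∑ j ∈ Finset.range m, x (2 * j + 1) := by
  have sum_const : (m : ℝ) * ((m + 1) * (2 * (c * t)))
      = ∑ j ∈ Finset.range m, ((m : ℝ) - j + (1 + j)) * (2 * (c * t)) := by simp
  rw [Finset.sum_range_succ, mul_add, ← sum_chain_pairs, sum_const]
  refine Finset.sum_le_sum fun j hj => ?_
  replace hj : j < m := Finset.mem_range.mp hj
  have sub_nonneg : (0 : ℝ) ≤ m - j := sub_nonneg.mpr (by exact_mod_cast hj.le)
  rw [add_mul]
  gcongr
  · exact two_mul_mul_le_add_sq_mul c (hx _ (by lia)) (hx _ (by lia)) (h _ (by lia))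
  · exact two_mul_mul_le_add_sq_mul c (hx _ (by lia)) (hx _ (by lia))
      ((h (2 * j + 1) (by lia)).trans_eq (mul_comm _ _))

theorem mul_sum_cSeq_le_sum_of_even (hm : 1 ≤ m) {x : ℕ → ℝ} (hx0 : ∀ i ≤ 2 * m, 0 ≤ x i)
    (hx1 : ∀ i ≤ 2 * m, x i ≤ 1) (h : ∀ i < 2 * m, t ^ 2 ≤ x i * x (i + 1)) :
    t * ∑ i ∈ Finset.range (2 * m + 1), cSeq (cParam t (2 * m)) i
      ≤ ∑ i ∈ Finset.range (2 * m + 1), x i := by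
  have weighted := le_even_sum_add_odd_sum (cParam t (2 * m)) hx0 h
  have c_pos : 0 < cParam t (2 * m) := cParam_pos t (by lia)
  have slack_nonneg := sub_nonneg.mpr (le_cParam_sq_mul t m)
  have m_pos : (0 : ℝ) < m := by exact_mod_cast hm
  have odd_sum_le : ∑ j ∈ Finset.range m, x (2 * j + 1) ≤ m := by
    simpa using Finset.sum_le_card_nsmul (Finset.range m) (fun j => x (2 * j + 1)) 1
      fun j hj => hx1 _ (by have := Finset.mem_range.mp hj; lia)
  rw [sum_cSeq_cParam, Finset.sum_range_succ, sum_range_two_mul, Finset.sum_add_distrib,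
    add_right_comm, ← Finset.sum_range_succ (fun j => x (2 * j))]
  refine le_of_mul_le_mul_left ?_ m_pos
  rcases cParam_eq_or_cParam_sq_mul_eq t m with hc | hc <;>
    generalize cParam t (2 * m) = c at * <;> push_cast
  · subst hc
    have slack_mul_le := mul_le_mul_of_nonneg_left odd_sum_le slack_nonneg
    have expand : m * (c * ((2 * m + 2) * c + 2 * m * c⁻¹) / 2) = m * ((m + 1) * c ^ 2 + m) := by
      field_simp
    linarith
  · rw [hc] at weighted
    have expand : m * (t * ((2 * m + 2) * c + 2 * m * c⁻¹) / 2)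
        = m * ((m + 1) * (2 * (c * t))) := by
      field_simp
      linear_combination (-t : ℝ) * hc
    linarith

theorem mul_sum_cSeq_le_sum_of_odd (hN : Odd N) {x : ℕ → ℝ} (hx : ∀ i ≤ N, 0 ≤ x i)
    (h : ∀ i < N, t ^ 2 ≤ x i * x (i + 1)) :
    t * ∑ i ∈ Finset.range (N + 1), cSeq (cParam t N) i ≤ ∑ i ∈ Finset.range (N + 1), x i := by
  obtain ⟨m, rfl⟩ := hN
  have pair_sum : ∑ _j ∈ Finset.range (m + 1), 2 * t
      ≤ ∑ j ∈ Finset.range (m + 1), (x (2 * j) + x (2 * j + 1)) := by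
    refine Finset.sum_le_sum fun j hj => ?_
    have := Finset.mem_range.mp hj
    simpa using
      two_mul_mul_le_add_sq_mul 1 (hx (2 * j) (by lia)) (hx _ (by lia)) (h _ (by lia))
  rw [Finset.sum_const, Finset.card_range, nsmul_eq_mul] at pair_sum
  rw [sum_cSeq_cParam, cParam_of_odd t (by simp), inv_one,
    show 2 * m + 1 + 1 = 2 * (m + 1) by ring, sum_range_two_mul]
  refine le_trans (le_of_eq ?_) pair_sum
  push_cast
  ring

theorem mul_sum_cSeq_le_sum (hN : 1 ≤ N) {x : ℕ → ℝ} (hx0 : ∀ i ≤ N, 0 ≤ x i)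
    (hx1 : ∀ i ≤ N, x i ≤ 1) (h : ∀ i < N, t ^ 2 ≤ x i * x (i + 1)) :
    t * ∑ i ∈ Finset.range (N + 1), cSeq (cParam t N) i ≤ ∑ i ∈ Finset.range (N + 1), x i := by
  rcases Nat.even_or_odd N with even | odd
  · obtain ⟨m, rfl⟩ := even_iff_exists_two_mul.mp even
    exact mul_sum_cSeq_le_sum_of_even (by lia) hx0 hx1 h
  · exact mul_sum_cSeq_le_sum_of_odd odd hx0 h

theorem average_le_of_sq_le (hN : 1 ≤ N) {p : Fin (N + 1) → ℝ} (hp0 : ∀ i, 0 ≤ p i)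
    (hp1 : ∀ i, p i ≤ 1) (h : ∀ i : Fin N, t ^ 2 ≤ (1 - p i.castSucc) * (1 - p i.succ)) :
    (∑ i, p i) / (N + 1) ≤ optimalAverage t N := by
  let x (i : ℕ) : ℝ := if hi : i < N + 1 then 1 - p ⟨i, hi⟩ else 0
  have x_eq (i : Fin (N + 1)) : x i = 1 - p i := dif_pos i.isLt
  have failure_le := mul_sum_cSeq_le_sum (t := t) hN (x := x)
    (fun i hi => by
      rw [x_eq ⟨i, by lia⟩]
      exact sub_nonneg.mpr (hp1 _))
    (fun i hi => by
      rw [x_eq ⟨i, by lia⟩]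
      exact sub_le_self _ (hp0 _))
    (fun i hi => by
      rw [x_eq ⟨i, by lia⟩, x_eq ⟨i + 1, by lia⟩]
      exact h ⟨i, hi⟩)
  simp only [← Fin.sum_univ_eq_sum_range, x_eq, Finset.sum_sub_distrib] at failure_le
  rw [optimalAverage, Finset.sum_sub_distrib, ← Finset.mul_sum]
  gcongr
  linarith

end ChainOptimization

section TensorVectors

variable {m n R : Type*} [Fintype m] [Fintype n]

/-- The product vector `φ ⊗ w`, in coordinates indexed by pairs as for the Kronecker product. -/
def tensorVec [Mul R] (φ : m → R) (w : n → R) : m × n → R := fun x => φ x.1 * w x.2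

theorem star_tensorVec_dotProduct [CommSemiring R] [StarRing R] (φ φ' : m → R) (w w' : n → R) :
    star (tensorVec φ w) ⬝ᵥ tensorVec φ' w' = (star φ ⬝ᵥ φ') * (star w ⬝ᵥ w') := by
  simp only [dotProduct, tensorVec, Pi.star_apply, star_mul', Finset.sum_mul_sum,
    Fintype.sum_prod_type, mul_mul_mul_comm]

theorem kronecker_mulVec_tensorVec [CommSemiring R] (A : Matrix m m R) (B : Matrix n n R)
    (φ : m → R) (w : n → R) :
    (A ⊗ₖ B).mulVec (tensorVec φ w) = tensorVec (A.mulVec φ) (B.mulVec w) := by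
  ext x
  simp only [Matrix.mulVec, dotProduct, tensorVec, Matrix.kroneckerMap_apply, Finset.sum_mul_sum,
    Fintype.sum_prod_type, mul_mul_mul_comm]

theorem exists_vectors_of_posSemidef [Nonempty m] {G : Matrix n n ℂ} (hG : G.PosSemidef) :
    ∃ ξ : n → m × n → ℂ, ∀ i j, star (ξ i) ⬝ᵥ ξ j = G i j := by
  classical
  obtain ⟨R, rfl⟩ := exists_eq_conjTranspose_mul_self hG
  let e : m → ℂ := Pi.single (Classical.arbitrary m) 1
  refine ⟨fun i => tensorVec e (R.col i), fun i j => ?_⟩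
  have star_e_dotProduct : star e ⬝ᵥ e = 1 := by simp [e]
  rw [star_tensorVec_dotProduct, star_e_dotProduct, one_mul]
  rfl

end TensorVectors

section AmpliatedUnitaries

variable {m n : Type*} [Fintype m] [DecidableEq m] [Fintype n] [DecidableEq n]

/-- The unitary `U ⊗ 1`, acting on the system in the presence of an ancilla. -/
def ampliateUnitary (n : Type*) [Fintype n] [DecidableEq n] (U : Matrix.unitaryGroup m ℂ) :
    Matrix.unitaryGroup (m × n) ℂ :=
  ⟨(U : Matrix m m ℂ) ⊗ₖ (1 : Matrix n n ℂ), Matrix.kronecker_mem_unitary U.2 (one_mem _)⟩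

theorem ampliateUnitary_mulVec_tensorVec (U : Matrix.unitaryGroup m ℂ) (φ : m → ℂ) (w : n → ℂ) :
    (ampliateUnitary n U : Matrix (m × n) (m × n) ℂ).mulVec (tensorVec φ w)
      = tensorVec ((U : Matrix m m ℂ).mulVec φ) w :=
  (kronecker_mulVec_tensorVec _ _ φ w).trans (by rw [Matrix.one_mulVec])

theorem star_mulVec_dotProduct_mulVec_eq_overlap (U₀ U₁ : Matrix.unitaryGroup m ℂ) (φ : m → ℂ) :
    star ((U₀ : Matrix m m ℂ).mulVec φ) ⬝ᵥ (U₁ : Matrix m m ℂ).mulVec φ = overlap U₀ U₁ φ :=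
  star_mulVec_dotProduct_mulVec _ _ φ φ

theorem overlap_self (U : Matrix.unitaryGroup m ℂ) (φ : m → ℂ) : overlap U U φ = star φ ⬝ᵥ φ := by
  rw [← star_mulVec_dotProduct_mulVec_eq_overlap, star_unitary_mulVec_dotProduct]

theorem star_overlap (U₀ U₁ : Matrix.unitaryGroup m ℂ) (φ : m → ℂ) :
    star (overlap U₀ U₁ φ) = overlap U₁ U₀ φ := by
  simp only [← star_mulVec_dotProduct_mulVec_eq_overlap]
  exact (Matrix.star_dotProduct _ _).symm

theorem overlap_ampliateUnitary (U₀ U₁ : Matrix.unitaryGroup m ℂ) (φ : m → ℂ) (w : n → ℂ) :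
    overlap (ampliateUnitary n U₀) (ampliateUnitary n U₁) (tensorVec φ w)
      = overlap U₀ U₁ φ * (star w ⬝ᵥ w) := by
  rw [← star_mulVec_dotProduct_mulVec_eq_overlap, ampliateUnitary_mulVec_tensorVec,
    ampliateUnitary_mulVec_tensorVec, star_tensorVec_dotProduct,
    star_mulVec_dotProduct_mulVec_eq_overlap]

theorem unitary_mul_mulVec (V W : Matrix.unitaryGroup m ℂ) (v : m → ℂ) :
    ((V * W : Matrix.unitaryGroup m ℂ) : Matrix m m ℂ).mulVec v
      = (V : Matrix m m ℂ).mulVec ((W : Matrix m m ℂ).mulVec v) :=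
  (Matrix.mulVec_mulVec _ _ _).symm

theorem exists_unitary_mulVec_eq_and_mulVec_eq (V₀ V₁ : Matrix.unitaryGroup m ℂ) {χ v w : m → ℂ}
    (hχ : star χ ⬝ᵥ χ = 1) (hv : star v ⬝ᵥ v = 1) (hw : star w ⬝ᵥ w = 1)
    (h : star w ⬝ᵥ v = overlap V₀ V₁ χ) :
    ∃ W : Matrix.unitaryGroup m ℂ, (W : Matrix m m ℂ).mulVec v = χ ∧
      ((V₁ * W : Matrix.unitaryGroup m ℂ) : Matrix m m ℂ).mulVec w
        = (V₀ : Matrix m m ℂ).mulVec χ := by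
  have h' : star v ⬝ᵥ w = overlap V₁ V₀ χ := by rw [Matrix.star_dotProduct, h, star_overlap]
  obtain ⟨W, hW⟩ := exists_unitary_mulVec_eq (v := ![v, w])
    (w := ![(V₁ : Matrix m m ℂ).mulVec χ, (V₀ : Matrix m m ℂ).mulVec χ]) (by
      simp [Fin.forall_fin_two, star_mulVec_dotProduct_mulVec_eq_overlap, overlap_self, hχ, hv, hw,
        h, h'])
  refine ⟨V₁⁻¹ * W, ?_, ?_⟩
  · rw [unitary_mul_mulVec, show (W : Matrix m m ℂ).mulVec v = _ from hW 0, Matrix.cons_val_zero,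
      ← unitary_mul_mulVec, inv_mul_cancel, Matrix.UnitaryGroup.one_val, Matrix.one_mulVec]
  · rw [mul_inv_cancel_left]
    exact hW 1

end AmpliatedUnitaries

section PureStates

variable {m n : Type*} [Fintype m]

theorem mul_vecMulVec_mul_conjTranspose (A : Matrix n m ℂ) (v : m → ℂ) :
    A * Matrix.vecMulVec v (star v) * A.conjTranspose
      = Matrix.vecMulVec (A.mulVec v) (star (A.mulVec v)) := by
  rw [Matrix.mul_vecMulVec, Matrix.vecMulVec_mul, Matrix.star_mulVec]

theorem trace_mul_vecMulVec_star (A : Matrix m m ℂ) (v : m → ℂ) :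
    (A * Matrix.vecMulVec v (star v)).trace = star v ⬝ᵥ A.mulVec v := by
  rw [Matrix.mul_vecMulVec, Matrix.trace_vecMulVec, dotProduct_comm]

theorem ampliation_unitaryChannel_vecMulVec [DecidableEq m] [Fintype n] [DecidableEq n]
    (U : Matrix.unitaryGroup m ℂ) (v : m × n → ℂ) :
    ampliation n (unitaryChannel U).map (Matrix.vecMulVec v (star v))
      = Matrix.vecMulVec ((ampliateUnitary n U : Matrix (m × n) (m × n) ℂ).mulVec v)
        (star ((ampliateUnitary n U : Matrix (m × n) (m × n) ℂ).mulVec v)) :=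
  (ampliation_unitaryChannel _ _).trans (mul_vecMulVec_mul_conjTranspose _ _)

end PureStates

namespace UnitaryStrategy

variable {ι κ : Type*} [Fintype ι] [DecidableEq ι] [Fintype κ] {a N : ℕ} (S : UnitaryStrategy ι a)

/-- The state vector just after the `(n+1)`-st channel, for the process of the unitary channels
given by `U 1, U 2, …`; `UnitaryStrategy.psi` is the case of a change point. -/
def stateVec (U : ℕ → Matrix.unitaryGroup ι ℂ) : (n : ℕ) → ι × Fin a → ℂ
  | 0 => (ampliateUnitary (Fin a) (U 1) : Matrix (ι × Fin a) (ι × Fin a) ℂ).mulVec S.vec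
  | n + 1 => (ampliateUnitary (Fin a) (U (n + 2)) : Matrix (ι × Fin a) (ι × Fin a) ℂ).mulVec
      ((S.gate n : Matrix (ι × Fin a) (ι × Fin a) ℂ).mulVec (stateVec U n))

theorem stateVec_changePoint (U₀ U₁ : Matrix.unitaryGroup ι ℂ) (k n : ℕ) :
    S.stateVec (fun n => if k < n then U₁ else U₀) n = S.psi U₀ U₁ k n := by
  induction n with
  | zero => rfl
  | succ n ih => rw [stateVec, ih]; rfl

theorem stateAfter_toTester (M : POVM κ (ι × Fin a)) (U : ℕ → Matrix.unitaryGroup ι ℂ) (n : ℕ) :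
    (S.toTester N M).stateAfter (fun n => unitaryChannel (U n)) n
      = Matrix.vecMulVec (S.stateVec U n) (star (S.stateVec U n)) := by
  induction n with
  | zero => exact ampliation_unitaryChannel_vecMulVec _ _
  | succ n ih =>
    rw [Tester.stateAfter, ih]
    exact (congrArg (ampliation (Fin a) (unitaryChannel (U (n + 2))).map)
      (mul_vecMulVec_mul_conjTranspose _ _)).trans (ampliation_unitaryChannel_vecMulVec _ _)

theorem prob_toTester (M : POVM κ (ι × Fin a)) (U : ℕ → Matrix.unitaryGroup ι ℂ) (x : κ) :
    (S.toTester N M).prob (fun n => unitaryChannel (U n)) x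
      = (star (S.stateVec U (N - 1)) ⬝ᵥ (M.elem x).mulVec (S.stateVec U (N - 1))).re := by
  rw [Tester.prob, stateAfter_toTester]
  exact congrArg Complex.re (trace_mul_vecMulVec_star _ _)

theorem exists_povm_isUnambiguous [DecidableEq κ] (N : ℕ) (U : κ → ℕ → Matrix.unitaryGroup ι ℂ)
    {p : κ → ℝ} (hp : ∀ k, 0 ≤ p k)
    (h : ((Matrix.of fun i j => star (S.stateVec (U i) (N - 1)) ⬝ᵥ S.stateVec (U j) (N - 1)) -
      Matrix.diagonal fun i => (p i : ℂ)).PosSemidef) :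
    ∃ M : POVM (Option κ) (ι × Fin a),
      (S.toTester N M).IsUnambiguous (fun k n => unitaryChannel (U k n)) ∧
      ∀ k, (S.toTester N M).success (fun k n => unitaryChannel (U k n)) k = p k := by
  obtain ⟨M, hM⟩ := exists_povm_of_posSemidef_gram_sub_diagonal _ hp h
  refine ⟨M, fun k j hjk => ?_, fun k => ?_⟩
  · rw [prob_toTester, hM, if_neg hjk.symm, Complex.zero_re]
  · rw [Tester.success, prob_toTester, hM, if_pos rfl, Complex.ofReal_re]

end UnitaryStrategy

section PairDiscrimination

theorem posSemidef_fin_two {a b : ℝ} {z : ℂ} (ha : 0 ≤ a) (hb : 0 ≤ b) (h : ‖z‖ ^ 2 ≤ a * b) :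
    !![(a : ℂ), z; star z, (b : ℂ)].PosSemidef := by
  refine .of_dotProduct_mulVec_nonneg ?_ fun x => ?_
  · ext i j
    fin_cases i <;> fin_cases j <;> simp
  · have quadratic_form : star x ⬝ᵥ !![(a : ℂ), z; star z, (b : ℂ)].mulVec x
        = ((a * ‖x 0‖ ^ 2 + b * ‖x 1‖ ^ 2 + 2 * (star (x 0) * z * x 1).re : ℝ) : ℂ) := by
      have two_mul_re : ((2 * (star (x 0) * z * x 1).re : ℝ) : ℂ)
          = star (x 0) * z * x 1 + star (star (x 0) * z * x 1) := (Complex.add_conj _).symm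
      rw [Complex.ofReal_add, two_mul_re]
      push_cast
      rw [← Complex.conj_mul', ← Complex.conj_mul']
      simp [dotProduct, Matrix.mulVec, Fin.sum_univ_two]
      ring
    have neg_le_re : -(‖x 0‖ * ‖z‖ * ‖x 1‖) ≤ (star (x 0) * z * x 1).re := by
      simpa using (abs_le.mp (Complex.abs_re_le_norm (star (x 0) * z * x 1))).1
    have am_gm := two_mul_mul_le_add_sq_mul 1 (s := ‖x 0‖ * ‖z‖ * ‖x 1‖)
      (mul_nonneg ha (sq_nonneg ‖x 0‖)) (mul_nonneg hb (sq_nonneg ‖x 1‖))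
      (by linear_combination ‖x 0‖ ^ 2 * ‖x 1‖ ^ 2 * h)
    rw [quadratic_form, Complex.zero_le_real]
    linarith

variable {ι : Type*} [Fintype ι] [DecidableEq ι]

theorem mem_pairRegion_of_sq_le (U₀ U₁ : Matrix.unitaryGroup ι ℂ) {φ : ι → ℂ}
    (hφ : star φ ⬝ᵥ φ = 1) {p q : ℝ} (hp : p ∈ Set.Icc 0 1) (hq : q ∈ Set.Icc 0 1)
    (h : ‖overlap U₀ U₁ φ‖ ^ 2 ≤ (1 - p) * (1 - q)) :
    (p, q) ∈ pairRegion (unitaryChannel U₀) (unitaryChannel U₁) := by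
  let w : Fin 1 → ℂ := 1
  have star_w_dotProduct : star w ⬝ᵥ w = 1 := by simp [w]
  let S : UnitaryStrategy ι 1 :=
    ⟨tensorVec φ w, by rw [star_tensorVec_dotProduct, hφ, star_w_dotProduct, one_mul], fun _ => 1⟩
  let U (j : Fin 2) (_ : ℕ) : Matrix.unitaryGroup ι ℂ := ![U₀, U₁] j
  have channel_eq : (fun j n => unitaryChannel (U j n))
      = fun j _ => ![unitaryChannel U₀, unitaryChannel U₁] j := by
    funext j n
    fin_cases j <;> rfl
  have star_stateVec_dotProduct (i j : Fin 2) :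
      star (S.stateVec (U i) 0) ⬝ᵥ S.stateVec (U j) 0 = overlap (U i 0) (U j 0) φ := by
    refine (star_mulVec_dotProduct_mulVec_eq_overlap _ _ _).trans ?_
    rw [overlap_ampliateUnitary, star_w_dotProduct, mul_one]
  obtain ⟨M, unambiguous, success⟩ := S.exists_povm_isUnambiguous 1 U (p := ![p, q])
    (by simp [Fin.forall_fin_two, hp.1, hq.1]) (by
      convert posSemidef_fin_two (sub_nonneg.mpr hp.2) (sub_nonneg.mpr hq.2) h using 1
      ext i j
      fin_cases i <;> fin_cases j <;>
        simp [star_stateVec_dotProduct, U, overlap_self, hφ, ← star_overlap U₀ U₁])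
  rw [channel_eq] at unambiguous success
  exact ⟨S.toTester 1 M, unambiguous, success 0, success 1⟩

end PairDiscrimination

section TargetGram

variable {N : ℕ} {t c : ℝ} {u : ℂ}

theorem muVec_mul_star_self (hc : 0 < c) (hu : ‖u‖ = 1) (i : Fin (N + 1)) :
    muVec N c u i * star (muVec N c u i) = cSeq c i := by
  rw [RCLike.star_def, Complex.mul_conj', muVec, norm_mul, norm_pow, hu, one_pow, one_mul,
    ← Complex.ofReal_pow, Complex.norm_of_nonneg (Real.sqrt_nonneg _),
    Real.sq_sqrt (cSeq_pos hc i).le]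

theorem muVec_succ_mul_star_castSucc (hc : 0 < c) (hu : ‖u‖ = 1) (i : Fin N) :
    muVec N c u i.succ * star (muVec N c u i.castSucc) = u := by
  have sqrt_mul_sqrt : ((√(cSeq c (i + 1)) : ℝ) : ℂ) * (√(cSeq c i) : ℝ) = 1 := by
    rw [← Complex.ofReal_mul, ← Real.sqrt_mul (cSeq_pos hc _).le, mul_comm,
      cSeq_mul_cSeq_succ hc.ne', Real.sqrt_one, Complex.ofReal_one]
  have pow_mul_star_pow : u ^ (i : ℕ) * star (u ^ (i : ℕ)) = 1 := by
    rw [RCLike.star_def, Complex.mul_conj', norm_pow, hu]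
    simp
  simp only [muVec, Fin.val_succ, Fin.val_castSucc, star_mul', RCLike.star_def,
    Complex.conj_ofReal] at pow_mul_star_pow ⊢
  linear_combination u * u ^ (i : ℕ) * starRingEnd ℂ (u ^ (i : ℕ)) * sqrt_mul_sqrt
    + u * pow_mul_star_pow

theorem targetGram_apply_self (hc : 0 < c) (hu : ‖u‖ = 1) (i : Fin (N + 1)) :
    targetGram N t c u i i = 1 := by
  rw [targetGram, Matrix.add_apply, Matrix.diagonal_apply_eq, Matrix.smul_apply,
    Matrix.vecMulVec_apply, Pi.star_apply, muVec_mul_star_self hc hu]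
  simp

theorem targetGram_succ_castSucc (hc : 0 < c) (hu : ‖u‖ = 1) (i : Fin N) :
    targetGram N t c u i.succ i.castSucc = t * u := by
  rw [targetGram, Matrix.add_apply, Matrix.diagonal_apply_ne _ i.castSucc_lt_succ.ne',
    Matrix.smul_apply, Matrix.vecMulVec_apply, Pi.star_apply, muVec_succ_mul_star_castSucc hc hu,
    zero_add, smul_eq_mul]

theorem posSemidef_targetGram_sub_diagonal (N : ℕ) (ht : 0 ≤ t) (c : ℝ) (u : ℂ) :
    (targetGram N t c u -
      Matrix.diagonal fun i : Fin (N + 1) => ((1 - t * cSeq c i : ℝ) : ℂ)).PosSemidef := by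
  rw [targetGram, add_sub_cancel_left]
  exact (Matrix.posSemidef_vecMulVec_self_star _).smul (Complex.zero_le_real.mpr ht)

theorem posSemidef_targetGram (N : ℕ) (ht : 0 ≤ t) (hc : ∀ i, t * cSeq c i ≤ 1) (u : ℂ) :
    (targetGram N t c u).PosSemidef :=
  sub_add_cancel (targetGram N t c u) _ ▸ (posSemidef_targetGram_sub_diagonal N ht c u).add
    (.diagonal fun _ => Complex.zero_le_real.mpr (sub_nonneg.mpr (hc _)))

end TargetGram

section OptimalStrategy

variable {ι : Type*} [Fintype ι] [DecidableEq ι] {a N : ℕ} (U₀ U₁ : Matrix.unitaryGroup ι ℂ)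

-- The gate `W (n + 1) (V₁ W n)⁻¹`, where `W n` sends `ξ n` to `χ` and `V₁ W n` sends `ξ (n + 1)`
-- to `V₀ χ`, turns the states at step `n` into those at step `n + 1` whatever the change point:
-- if it is not reached, `V₀` or `V₁` acting on `χ` splits it off as `ξ (n + 1)`.
theorem exists_unitaryStrategy_psi_eq {χ : ι × Fin a → ℂ} (hχ : star χ ⬝ᵥ χ = 1)
    {ξ : ℕ → ι × Fin a → ℂ} (hξ : ∀ n ≤ N, star (ξ n) ⬝ᵥ ξ n = 1)
    (h : ∀ n < N, star (ξ (n + 1)) ⬝ᵥ ξ n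
      = overlap (ampliateUnitary (Fin a) U₀) (ampliateUnitary (Fin a) U₁) χ) :
    ∃ (S : UnitaryStrategy ι a) (V : ℕ → Matrix.unitaryGroup (ι × Fin a) ℂ), ∀ k, ∀ n < N,
      S.psi U₀ U₁ k n
        = (V n : Matrix (ι × Fin a) (ι × Fin a) ℂ).mulVec (ξ (min k (n + 1))) := by
  let V (k n : ℕ) := ampliateUnitary (Fin a) (if k < n then U₁ else U₀)
  choose! W W_left W_right using fun n hn => exists_unitary_mulVec_eq_and_mulVec_eq
    (ampliateUnitary (Fin a) U₀) (ampliateUnitary (Fin a) U₁) hχ (hξ n (le_of_lt hn))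
    (hξ (n + 1) hn) (h n hn)
  have V_mulVec_W (k n : ℕ) (hn : n < N) :
      (V k (n + 1) : Matrix (ι × Fin a) (ι × Fin a) ℂ).mulVec
        ((W n : Matrix (ι × Fin a) (ι × Fin a) ℂ).mulVec (ξ (min k n)))
      = ((ampliateUnitary (Fin a) U₁ * W n : Matrix.unitaryGroup (ι × Fin a) ℂ) :
          Matrix (ι × Fin a) (ι × Fin a) ℂ).mulVec (ξ (min k (n + 1))) := by
    by_cases hk : k < n + 1
    · rw [min_eq_left (by lia), min_eq_left (by lia), unitary_mul_mulVec]
      simp only [V, if_pos hk]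
    · rw [min_eq_right (by lia), min_eq_right (by lia), W_left n hn, W_right n hn]
      simp only [V, if_neg hk]
  have gate_mulVec (n : ℕ) (v : ι × Fin a → ℂ) :
      ((W (n + 1) * (ampliateUnitary (Fin a) U₁ * W n)⁻¹ : Matrix.unitaryGroup (ι × Fin a) ℂ) :
          Matrix (ι × Fin a) (ι × Fin a) ℂ).mulVec
        (((ampliateUnitary (Fin a) U₁ * W n : Matrix.unitaryGroup (ι × Fin a) ℂ) :
          Matrix (ι × Fin a) (ι × Fin a) ℂ).mulVec v)
      = (W (n + 1) : Matrix (ι × Fin a) (ι × Fin a) ℂ).mulVec v := by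
    rw [← unitary_mul_mulVec, inv_mul_cancel_right]
  refine ⟨⟨χ, hχ, fun n => W (n + 1) * (ampliateUnitary (Fin a) U₁ * W n)⁻¹⟩,
    fun n => ampliateUnitary (Fin a) U₁ * W n, fun k n hn => ?_⟩
  rw [← UnitaryStrategy.stateVec_changePoint]
  induction n with
  | zero =>
    rw [← V_mulVec_W k 0 hn, Nat.min_zero, W_left 0 hn]
    rfl
  | succ n ih =>
    rw [← V_mulVec_W k (n + 1) hn, ← gate_mulVec, UnitaryStrategy.stateVec, ih (by lia),
      unitary_mul_mulVec]

theorem exists_unitaryStrategy_gram_eq (hN : 1 ≤ N) {t c : ℝ} (ht : 0 ≤ t) (hc : 0 < c)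
    (htc : ∀ i, t * cSeq c i ≤ 1) {φ : ι → ℂ} {u : ℂ} (hφ : star φ ⬝ᵥ φ = 1) (hu : ‖u‖ = 1)
    (h : overlap U₀ U₁ φ = t * u) :
    ∃ S : UnitaryStrategy ι (N + 1), S.gram U₀ U₁ N = targetGram N t c u := by
  have : Nonempty ι := by
    by_contra hι
    rw [not_nonempty_iff] at hι
    simp at hφ
  let e : Fin (N + 1) → ℂ := Pi.single 0 1
  have star_e_dotProduct : star e ⬝ᵥ e = 1 := by simp [e]
  obtain ⟨ξ, hξ⟩ := exists_vectors_of_posSemidef (m := ι) (posSemidef_targetGram N ht htc u)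
  have ofNat_val (i : Fin (N + 1)) : Fin.ofNat (N + 1) i = i := Fin.ofNat_val_eq_self i
  obtain ⟨S, V, hS⟩ := exists_unitaryStrategy_psi_eq (N := N) U₀ U₁ (χ := tensorVec φ e)
    (by rw [star_tensorVec_dotProduct, hφ, star_e_dotProduct, one_mul])
    (ξ := fun n => ξ (Fin.ofNat (N + 1) n))
    (fun n _ => by rw [hξ, targetGram_apply_self hc hu])
    (fun n hn => by
      rw [hξ, overlap_ampliateUnitary, star_e_dotProduct, mul_one, h,
        ← targetGram_succ_castSucc (t := t) hc hu ⟨n, hn⟩]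
      congr 1
      · exact ofNat_val (Fin.succ ⟨n, hn⟩)
      · exact ofNat_val (Fin.castSucc ⟨n, hn⟩))
  refine ⟨S, ?_⟩
  ext i j
  have last_step : N - 1 < N := by lia
  rw [UnitaryStrategy.gram, Matrix.of_apply, hS _ _ last_step, hS _ _ last_step,
    star_unitary_mulVec_dotProduct, Nat.sub_add_cancel hN, min_eq_left i.is_le,
    min_eq_left j.is_le, ofNat_val, ofNat_val, hξ]

theorem changeProcess_unitaryChannel (N : ℕ) :
    changeProcess (unitaryChannel U₀) (unitaryChannel U₁) N
      = fun (k : Fin (N + 1)) n => unitaryChannel (if (k : ℕ) < n then U₁ else U₀) := by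
  funext k n
  exact (apply_ite unitaryChannel _ _ _).symm

theorem exists_unitaryStrategy_success_eq (hN : 1 ≤ N) {t c : ℝ} (ht : 0 ≤ t) (hc : 0 < c)
    (htc : ∀ i, t * cSeq c i ≤ 1) {φ : ι → ℂ} {u : ℂ} (hφ : star φ ⬝ᵥ φ = 1) (hu : ‖u‖ = 1)
    (h : overlap U₀ U₁ φ = t * u) :
    ∃ (S : UnitaryStrategy ι (N + 1)) (M : POVM (Option (Fin (N + 1))) (ι × Fin (N + 1))),
      S.gram U₀ U₁ N = targetGram N t c u ∧
      (S.toTester N M).IsUnambiguous (changeProcess (unitaryChannel U₀) (unitaryChannel U₁) N) ∧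
      ∀ k : Fin (N + 1), (S.toTester N M).success
        (changeProcess (unitaryChannel U₀) (unitaryChannel U₁) N) k = 1 - t * cSeq c k := by
  obtain ⟨S, hS⟩ := exists_unitaryStrategy_gram_eq U₀ U₁ hN ht hc htc hφ hu h
  have posSemidef := posSemidef_targetGram_sub_diagonal N ht c u
  rw [← hS] at posSemidef
  rw [changeProcess_unitaryChannel]
  obtain ⟨M, hM⟩ := S.exists_povm_isUnambiguous N
    (fun (k : Fin (N + 1)) n => if (k : ℕ) < n then U₁ else U₀)
    (fun k => sub_nonneg.mpr (htc k)) (by simpa only [UnitaryStrategy.stateVec_changePoint])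
  exact ⟨S, M, hS, hM⟩

end OptimalStrategy

section OptimalValues

variable {ι : Type*} [Fintype ι] [DecidableEq ι] [Nonempty ι] (U₀ U₁ : Matrix.unitaryGroup ι ℂ)

theorem minOverlap_le_one : minOverlap U₀ U₁ ≤ 1 := by
  obtain ⟨i⟩ := ‹Nonempty ι›
  have overlap_single : overlap U₀ U₁ (Pi.single i 1)
      = ((star U₀ * U₁ : Matrix.unitaryGroup ι ℂ) : Matrix ι ι ℂ) i i := by
    simp [overlap, Matrix.star_eq_conjTranspose]
  refine ((isLeast_overlapValues U₀ U₁).2 ⟨Pi.single i 1, by simp, rfl⟩).trans ?_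
  rw [overlap_single]
  exact entry_norm_bound_of_unitary (star U₀ * U₁).2 i i

theorem mem_pairRegion_iff {p q : ℝ} :
    (p, q) ∈ pairRegion (unitaryChannel U₀) (unitaryChannel U₁) ↔
      p ∈ Set.Icc 0 1 ∧ q ∈ Set.Icc 0 1 ∧ minOverlap U₀ U₁ ^ 2 ≤ (1 - p) * (1 - q) := by
  constructor
  · rintro ⟨T, unambiguous, rfl, rfl⟩
    exact ⟨⟨T.prob_nonneg _ _, T.prob_le_one _ _⟩, ⟨T.prob_nonneg _ _, T.prob_le_one _ _⟩,
      T.minOverlap_sq_le (fun _ => unitaryChannel U₀) U₀ U₁ one_pos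
        (unambiguous 1 0 zero_ne_one) (unambiguous 0 1 one_ne_zero)⟩
  · rintro ⟨hp, hq, h⟩
    obtain ⟨φ, hφ, norm_overlap⟩ := (isLeast_overlapValues U₀ U₁).1
    exact mem_pairRegion_of_sq_le U₀ U₁ hφ hp hq (norm_overlap ▸ h)

theorem mem_Icc_of_mem_pairRegion {p q : ℝ}
    (h : (p, q) ∈ pairRegion (unitaryChannel U₀) (unitaryChannel U₁)) :
    p ∈ Set.Icc 0 (1 - minOverlap U₀ U₁ ^ 2) ∧ q ∈ Set.Icc 0 (1 - minOverlap U₀ U₁ ^ 2) := by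
  obtain ⟨⟨hp0, hp1⟩, ⟨hq0, hq1⟩, h⟩ := (mem_pairRegion_iff U₀ U₁).mp h
  exact ⟨⟨hp0, by nlinarith⟩, ⟨hq0, by nlinarith⟩⟩

theorem zero_mem_Icc_one_sub_minOverlap_sq : (0 : ℝ) ∈ Set.Icc 0 (1 - minOverlap U₀ U₁ ^ 2) :=
  Set.left_mem_Icc.mpr
    (sub_nonneg.mpr (pow_le_one₀ (minOverlap_nonneg U₀ U₁) (minOverlap_le_one U₀ U₁)))

theorem isGreatest_identifiable₁ {p : ℝ} (hp : p ∈ Set.Icc 0 (1 - minOverlap U₀ U₁ ^ 2)) :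
    IsGreatest (identifiable₁ (unitaryChannel U₀) (unitaryChannel U₁) p)
      (1 - minOverlap U₀ U₁ ^ 2 / (1 - p)) := by
  have sq_nonneg := sq_nonneg (minOverlap U₀ U₁)
  have sq_le : minOverlap U₀ U₁ ^ 2 ≤ 1 - p := le_sub_comm.mp hp.2
  have one_sub_nonneg : 0 ≤ 1 - p := sq_nonneg.trans sq_le
  refine ⟨(mem_pairRegion_iff U₀ U₁).mpr ⟨⟨hp.1, sub_nonneg.mp one_sub_nonneg⟩,
    ⟨sub_nonneg.mpr (div_le_one_of_le₀ sq_le one_sub_nonneg),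
      sub_le_self _ (div_nonneg sq_nonneg one_sub_nonneg)⟩, ?_⟩, fun q hq => ?_⟩
  · rw [sub_sub_cancel, mul_div_cancel_of_imp' fun h => le_antisymm (h ▸ sq_le) sq_nonneg]
  · obtain ⟨-, ⟨-, hq1⟩, h⟩ := (mem_pairRegion_iff U₀ U₁).mp hq
    exact le_sub_comm.mp
      (div_le_of_le_mul₀ one_sub_nonneg (sub_nonneg.mpr hq1) (h.trans_eq (mul_comm _ _)))

theorem isGreatest_tradeoff {p : ℝ} (hp : p ∈ Set.Icc 0 (1 - minOverlap U₀ U₁ ^ 2)) :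
    IsGreatest (identifiable₁ (unitaryChannel U₀) (unitaryChannel U₁) p)
      (tradeoff (unitaryChannel U₀) (unitaryChannel U₁) p) := by
  have h := isGreatest_identifiable₁ U₀ U₁ hp
  rwa [← h.csSup_eq] at h

theorem mem_Icc_tradeoff_iff {p q : ℝ} (hp : p ∈ Set.Icc 0 (1 - minOverlap U₀ U₁ ^ 2)) :
    q ∈ Set.Icc 0 (tradeoff (unitaryChannel U₀) (unitaryChannel U₁) p) ↔
      (p, q) ∈ pairRegion (unitaryChannel U₀) (unitaryChannel U₁) := by
  obtain ⟨tradeoff_mem, le_tradeoff⟩ := isGreatest_tradeoff U₀ U₁ hp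
  refine ⟨fun ⟨hq0, hq⟩ => ?_, fun h =>
    ⟨(mem_Icc_of_mem_pairRegion U₀ U₁ h).2.1, le_tradeoff h⟩⟩
  obtain ⟨hp', ⟨-, tradeoff_le_one⟩, h⟩ := (mem_pairRegion_iff U₀ U₁).mp tradeoff_mem
  exact (mem_pairRegion_iff U₀ U₁).mpr ⟨hp', ⟨hq0, hq.trans tradeoff_le_one⟩,
    h.trans (mul_le_mul_of_nonneg_left (sub_le_sub_left hq 1) (sub_nonneg.mpr hp'.2))⟩

theorem isGreatest_identifiable₀ :
    IsGreatest (identifiable₀ (unitaryChannel U₀) (unitaryChannel U₁))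
      (1 - minOverlap U₀ U₁ ^ 2) := by
  have h := zero_mem_Icc_one_sub_minOverlap_sq U₀ U₁
  refine ⟨⟨0, (mem_pairRegion_iff U₀ U₁).mpr ⟨⟨h.2, sub_le_self _ (sq_nonneg _)⟩,
    Set.left_mem_Icc.mpr zero_le_one, ?_⟩⟩, fun p ⟨q, hpq⟩ =>
      (mem_Icc_of_mem_pairRegion U₀ U₁ hpq).1.2⟩
  rw [sub_sub_cancel, sub_zero, mul_one]

theorem pbar_eq : pbar (unitaryChannel U₀) (unitaryChannel U₁) = 1 - minOverlap U₀ U₁ ^ 2 :=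
  (isGreatest_identifiable₀ U₀ U₁).csSup_eq

theorem tradeoff_zero_le_pbar :
    tradeoff (unitaryChannel U₀) (unitaryChannel U₁) 0
      ≤ pbar (unitaryChannel U₀) (unitaryChannel U₁) :=
  pbar_eq U₀ U₁ ▸ (mem_Icc_of_mem_pairRegion U₀ U₁
    (isGreatest_tradeoff U₀ U₁ (zero_mem_Icc_one_sub_minOverlap_sq U₀ U₁)).1).2.2

variable {N : ℕ}

theorem mem_boundValues_iff {P : ℝ} :
    P ∈ boundValues (unitaryChannel U₀) (unitaryChannel U₁) N ↔
      ∃ p : Fin (N + 1) → ℝ, (∀ i, p i ∈ Set.Icc 0 (1 - minOverlap U₀ U₁ ^ 2)) ∧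
        (∀ i : Fin N, (p i.succ, p i.castSucc)
          ∈ pairRegion (unitaryChannel U₀) (unitaryChannel U₁)) ∧
        (∑ i, p i) / (N + 1) = P := by
  constructor
  · rintro ⟨p, last_mem, castSucc_mem, average⟩
    rw [pbar_eq] at last_mem
    have mem_Icc (i : Fin (N + 1)) : p i ∈ Set.Icc 0 (1 - minOverlap U₀ U₁ ^ 2) := by
      induction i using Fin.reverseInduction with
      | last => exact last_mem
      | cast i ih =>
        exact (mem_Icc_of_mem_pairRegion U₀ U₁
          ((mem_Icc_tradeoff_iff U₀ U₁ ih).mp (castSucc_mem i))).2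
    exact ⟨p, mem_Icc, fun i => (mem_Icc_tradeoff_iff U₀ U₁ (mem_Icc _)).mp (castSucc_mem i),
      average⟩
  · rintro ⟨p, mem_Icc, pair_mem, average⟩
    exact ⟨p, pbar_eq U₀ U₁ ▸ mem_Icc _,
      fun i => (mem_Icc_tradeoff_iff U₀ U₁ (mem_Icc _)).mpr (pair_mem i), average⟩

theorem isGreatest_boundValues (hN : 1 ≤ N) :
    IsGreatest (boundValues (unitaryChannel U₀) (unitaryChannel U₁) N)
      (optimalAverage (minOverlap U₀ U₁) N) := by
  set t := minOverlap U₀ U₁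
  have t_nonneg : 0 ≤ t := minOverlap_nonneg U₀ U₁
  have t_le_one : t ≤ 1 := minOverlap_le_one U₀ U₁
  set c := cParam t N
  have c_pos : 0 < c := cParam_pos t hN
  constructor
  · have mem_Icc (i : ℕ) : 1 - t * cSeq c i ∈ Set.Icc (0 : ℝ) 1 :=
      ⟨sub_nonneg.mpr
          (mul_cSeq_le_one (le_cParam t_le_one N) c_pos (cParam_le_one t_le_one N) i),
        sub_le_self _ (mul_nonneg t_nonneg (cSeq_pos c_pos i).le)⟩
    have pair_mem (i : ℕ) : (1 - t * cSeq c (i + 1), 1 - t * cSeq c i)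
        ∈ pairRegion (unitaryChannel U₀) (unitaryChannel U₁) := by
      refine (mem_pairRegion_iff U₀ U₁).mpr ⟨mem_Icc _, mem_Icc _, le_of_eq ?_⟩
      linear_combination -t ^ 2 * cSeq_mul_cSeq_succ c_pos.ne' i
    exact (mem_boundValues_iff U₀ U₁).mpr ⟨fun i => 1 - t * cSeq c i,
      fun i => (mem_Icc_of_mem_pairRegion U₀ U₁ (pair_mem i)).2, fun i => pair_mem i, rfl⟩
  · intro P hP
    obtain ⟨p, mem_Icc, pair_mem, rfl⟩ := (mem_boundValues_iff U₀ U₁).mp hP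
    exact average_le_of_sq_le hN (fun i => (mem_Icc i).1)
      (fun i => (mem_Icc i).2.trans (sub_le_self _ (sq_nonneg t)))
      fun i => ((mem_pairRegion_iff U₀ U₁).mp (pair_mem i)).2.2.trans_eq (mul_comm _ _)

theorem update_changeProcess_castSucc {V W : Type*} [Fintype V] [Fintype W]
    (Λ₀ Λ₁ : Channel V W) (i : Fin N) :
    Function.update (changeProcess Λ₀ Λ₁ N i.castSucc) (i + 1) Λ₀
      = changeProcess Λ₀ Λ₁ N i.succ := by
  funext n
  simp only [Function.update_apply, changeProcess, Fin.val_castSucc, Fin.val_succ]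
  grind

theorem update_changeProcess_castSucc_self {V W : Type*} [Fintype V] [Fintype W]
    (Λ₀ Λ₁ : Channel V W) (i : Fin N) :
    Function.update (changeProcess Λ₀ Λ₁ N i.castSucc) (i + 1) Λ₁
      = changeProcess Λ₀ Λ₁ N i.castSucc :=
  Function.update_eq_self_iff.mpr (if_pos (by simp)).symm

theorem averageSuccess_le (hN : 1 ≤ N) {T : Tester ι ι N (Option (Fin (N + 1)))}
    (hT : T.IsUnambiguous (changeProcess (unitaryChannel U₀) (unitaryChannel U₁) N)) :
    averageSuccess (unitaryChannel U₀) (unitaryChannel U₁) N T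
      ≤ optimalAverage (minOverlap U₀ U₁) N := by
  refine average_le_of_sq_le hN (fun i => T.prob_nonneg _ _) (fun i => T.prob_le_one _ _)
    fun i => ?_
  have key := T.minOverlap_sq_le (changeProcess (unitaryChannel U₀) (unitaryChannel U₁) N
    i.castSucc) U₀ U₁ i.isLt (x := some i.succ) (y := some i.castSucc)
  rw [update_changeProcess_castSucc, update_changeProcess_castSucc_self] at key
  exact (key (hT _ _ i.castSucc_lt_succ.ne') (hT _ _ i.castSucc_lt_succ.ne)).trans_eq
    (mul_comm _ _)

theorem exists_optimal_unitaryStrategy (hN : 1 ≤ N) {φ : ι → ℂ} {u : ℂ} (hφ : star φ ⬝ᵥ φ = 1)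
    (hu : ‖u‖ = 1) (h : overlap U₀ U₁ φ = minOverlap U₀ U₁ * u) :
    ∃ (a : ℕ) (S : UnitaryStrategy ι a) (M : POVM (Option (Fin (N + 1))) (ι × Fin a)),
      S.gram U₀ U₁ N
        = targetGram N (minOverlap U₀ U₁) (cParam (minOverlap U₀ U₁) N) u ∧
      (S.toTester N M).IsUnambiguous (changeProcess (unitaryChannel U₀) (unitaryChannel U₁) N) ∧
      (∀ k : Fin (N + 1), (S.toTester N M).success
        (changeProcess (unitaryChannel U₀) (unitaryChannel U₁) N) k
          = 1 - minOverlap U₀ U₁ * cSeq (cParam (minOverlap U₀ U₁) N) k) ∧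
      averageSuccess (unitaryChannel U₀) (unitaryChannel U₁) N (S.toTester N M)
        = optimalAverage (minOverlap U₀ U₁) N := by
  have t_le_one := minOverlap_le_one U₀ U₁
  have c_pos := cParam_pos (minOverlap U₀ U₁) hN
  obtain ⟨S, M, gram_eq, unambiguous, success_eq⟩ := exists_unitaryStrategy_success_eq U₀ U₁ hN
    (minOverlap_nonneg U₀ U₁) c_pos
    (mul_cSeq_le_one (le_cParam t_le_one N) c_pos (cParam_le_one t_le_one N)) hφ hu h
  refine ⟨N + 1, S, M, gram_eq, unambiguous, success_eq, ?_⟩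
  simp only [averageSuccess, optimalAverage, success_eq]

theorem isGreatest_achievableValues (hN : 1 ≤ N) :
    IsGreatest (achievableValues (unitaryChannel U₀) (unitaryChannel U₁) N)
      (optimalAverage (minOverlap U₀ U₁) N) := by
  constructor
  · obtain ⟨φ, hφ, norm_overlap⟩ := (isLeast_overlapValues U₀ U₁).1
    obtain ⟨_, S, M, -, unambiguous, -, average⟩ := exists_optimal_unitaryStrategy U₀ U₁ hN hφ
      (Complex.norm_exp_ofReal_mul_I (overlap U₀ U₁ φ).arg)
      (by rw [← norm_overlap, Complex.norm_mul_exp_arg_mul_I])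
    exact ⟨S.toTester N M, unambiguous, average⟩
  · rintro P ⟨T, unambiguous, rfl⟩
    exact averageSuccess_le U₀ U₁ hN unambiguous

end OptimalValues

end ChangePoint

theorem theorem2 {ι : Type*} [Fintype ι] [DecidableEq ι] [Nonempty ι]
    (U₀ U₁ : Matrix.unitaryGroup ι ℂ) (N : ℕ) (hN : 1 ≤ N)
    (Λ₀ Λ₁ : ChangePoint.Channel ι ι)
    (hΛ₀ : Λ₀ = ChangePoint.unitaryChannel U₀) (hΛ₁ : Λ₁ = ChangePoint.unitaryChannel U₁)
    (t c : ℝ) (ht : t = ChangePoint.minOverlap U₀ U₁) (hc : c = ChangePoint.cParam t N) :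
    -- all the extrema that enter the statement are attained
    IsLeast (ChangePoint.overlapValues U₀ U₁) t ∧
    IsGreatest (ChangePoint.identifiable₀ Λ₀ Λ₁) (ChangePoint.pbar Λ₀ Λ₁) ∧
    (∀ p ∈ Set.Icc 0 (ChangePoint.pbar Λ₀ Λ₁),
      IsGreatest (ChangePoint.identifiable₁ Λ₀ Λ₁ p) (ChangePoint.tradeoff Λ₀ Λ₁ p)) ∧
    ChangePoint.tradeoff Λ₀ Λ₁ 0 ≤ ChangePoint.pbar Λ₀ Λ₁ ∧
    IsGreatest (ChangePoint.boundValues Λ₀ Λ₁ N) (ChangePoint.upperBound Λ₀ Λ₁ N) ∧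
    IsGreatest (ChangePoint.achievableValues Λ₀ Λ₁ N) (ChangePoint.optimalSuccess Λ₀ Λ₁ N) ∧
    -- the maximum equals the upper bound, with its closed form
    ChangePoint.optimalSuccess Λ₀ Λ₁ N = ChangePoint.upperBound Λ₀ Λ₁ N ∧
    ChangePoint.optimalSuccess Λ₀ Λ₁ N
      = 1 - t * ((((N : ℝ) + 2) * c + (N : ℝ) * c⁻¹) / (2 * ((N : ℝ) + 1))) ∧
    -- an optimal sequential strategy with the stated Gram matrix
    (∀ (φ : ι → ℂ) (u : ℂ), star φ ⬝ᵥ φ = 1 → ‖u‖ = 1 →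
      ChangePoint.overlap U₀ U₁ φ = (t : ℂ) * u →
      ∃ (a : ℕ) (S : ChangePoint.UnitaryStrategy ι a)
        (M : ChangePoint.POVM (Option (Fin (N + 1))) (ι × Fin a)),
        S.gram U₀ U₁ N = ChangePoint.targetGram N t c u ∧
        (S.toTester N M).IsUnambiguous (ChangePoint.changeProcess Λ₀ Λ₁ N) ∧
        (∀ k : Fin (N + 1),
          (S.toTester N M).success (ChangePoint.changeProcess Λ₀ Λ₁ N) k
            = 1 - t * ChangePoint.cSeq c k) ∧
        ChangePoint.averageSuccess Λ₀ Λ₁ N (S.toTester N M)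
          = ChangePoint.optimalSuccess Λ₀ Λ₁ N) := by
  subst hΛ₀ hΛ₁ ht hc
  have bound := ChangePoint.isGreatest_boundValues U₀ U₁ hN
  have achievable := ChangePoint.isGreatest_achievableValues U₀ U₁ hN
  have upperBound_eq : ChangePoint.upperBound _ _ N = _ := bound.csSup_eq
  have optimalSuccess_eq : ChangePoint.optimalSuccess _ _ N = _ := achievable.csSup_eq
  rw [upperBound_eq, optimalSuccess_eq, ← ChangePoint.optimalAverage_eq]
  refine ⟨ChangePoint.isLeast_overlapValues U₀ U₁, ?_, fun p hp => ?_,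
    ChangePoint.tradeoff_zero_le_pbar U₀ U₁, bound, achievable, rfl, rfl, fun φ u =>
      ChangePoint.exists_optimal_unitaryStrategy U₀ U₁ hN⟩
  · rw [ChangePoint.pbar_eq]
    exact ChangePoint.isGreatest_identifiable₀ U₀ U₁
  · rw [ChangePoint.pbar_eq] at hp
    exact ChangePoint.isGreatest_tradeoff U₀ U₁ hp
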